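/- **Conventions.** For integers $b\le c$ write $[b,c]=\{b,b+1,\dots,c\}$; an equation $\varphi(x)=[b,c]$ stands for the hyperplanes $\varphi(x)=k$, $k\in[b,c]$. The cone $\mathbf c\mathcal A$ over an arrangement $\mathcal A$ of affine hyperplanes $\varphi(x)=k$ in a real vector space $V$ is the central arrangement in $V\times\mathbb R$ (last coordinate $z$) consisting of $z=0$ and of the hyperplanes $\varphi(x)=kz$. Let $\mathcal A$ be a central arrangement in $V$, $\dim V=r$, with coordinate ring $S$ and defining polynomial $Q$. It is free with exponents $(e_1,\dots,e_r)$ if the $S$-module of derivations $\theta$ of $S$ with $\theta(Q)\in QS$ has a homogeneous basis of degrees $e_1,\dots,e_r$. For a subspace $X$, $\mathcal A^X=\{H\cap X\mid H\in\mathcal A,\ X\not\subseteq H\}$ is the restriction to $X$. The inductively free arrangements form the smallest class that contains all empty arrangements and contains $\mathcal A$ whenever, for some $H\in\mathcal A$, it contains $\mathcal A^H$ and $\mathcal A\setminus\{H\}$ and $\exp(\mathcal A^H)\subseteq\exp(\mathcal A\setminus\{H\})$ as multisets. A free arrangement $\mathcal A$ with exponents $e_1\le\dots\le e_r$ is ind-flag-accurate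 if it is inductively free and there are intersections $X_1\subseteq X_2\subseteq\dots\subseteq X_r=V$ of hyperplanes of $\mathcal A$ with $\dim X_d=d$ such that each $\mathcal A^{X_d}$ is inductively free with exponents $(e_1,\dots,e_d)$. **Theorem.** (1) Let $m\ge0$, $a,n,\ell\ge1$ and $0\le p\le\ell$ be integers, and let $\mathcal H^p_\ell(m,a,n)$ be the arrangement in $\mathbb R^\ell$ consisting of $$x_i-x_j=[1-a,a]\ (1\le i<j\le\ell),\qquad x_i=[-m,na-1]\ (1\le i\le p),\qquad x_i=[-m-1,na-1]\ (p<i\le\ell).$$ The cone over $\mathcal H^p_\ell(m,a,n)$ is ind-flag-accurate with exponents $$(1,0^p,1^{\ell-p})+(0,(m+a(\ell+n-1))^\ell).$$ (2) For integers $m,d\ge0$, $\ell\ge1$, $0\le p\le\ell$ and $1\le k\le\ell$ let $\mathcal A^{p,k}_\ell(m,d)$ be the arrangement in $\mathbb R^\ell$ consisting of $x_i-x_j=0$ $(1\le i<j\le\ell)$, $x_i-x_j=1$ $(1\le i<j\le\ell+1-k)$, $x_i=[1-\min\{\ell-i+1,k\}-m,d]$ $(1\le i\le p)$ and $x_i=[-\min\{\ell-i+1,k\}-m,d]$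 $(p<i\le\ell)$; for fixed $p$ these form a Shi descendant sequence with origin $\mathcal A^{p,1}_\ell(m,d)$. The origin satisfies $\mathcal A^{p,1}_\ell(m,d)=\mathcal H^p_\ell(m,1,d+1)$, and its cone is ind-flag-accurate with exponents $(1,(\ell+m+d)^p,(\ell+m+d+1)^{\ell-p})$. (3) For $m,\ell\ge1$ the cone over the extended Shi arrangement of type $A_\ell$, that is, over the arrangement $x_i-x_j=[1-m,m]$ $(1\le i<j\le\ell+1)$ in $\{x\in\mathbb R^{\ell+1}\mid\sum_i x_i=0\}$, is ind-flag-accurate. -/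

import Mathlib

universe u

/-- A central hyperplane arrangement in `V`: a finite set of linear hyperplanes
(linear subspaces of codimension one). -/
@[ext]
structure CentralArrangement (K : Type*) (V : Type*) [Field K] [AddCommGroup V] [Module K V] where
  /-- the hyperplanes of the arrangement -/
  hyperplanes : Set (Submodule K V)
  finite : hyperplanes.Finite
  isCoatom : ∀ H ∈ hyperplanes, IsCoatom H

namespace CentralArrangement

section Basic

variable {K : Type*} {V : Type*} [Field K] [AddCommGroup V] [Module K V]

/-- The empty arrangement in `V`. -/
def empty (K : Type*) (V : Type*) [Field K] [AddCommGroup V] [Module K V] :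
    CentralArrangement K V where
  hyperplanes := ∅
  finite := Set.finite_empty
  isCoatom := by simp

/-- The deletion `A' = A ∖ {H}`. -/
def delete (A : CentralArrangement K V) (H : Submodule K V) : CentralArrangement K V where
  hyperplanes := A.hyperplanes \ {H}
  finite := A.finite.sdiff
  isCoatom := fun H' h => A.isCoatom H' h.1

theorem isCoatom_comap_subtype {X H : Submodule K V} (hH : IsCoatom H) (hX : ¬ X ≤ H) :
    IsCoatom (H.comap X.subtype) := by
  have hm : ∀ Y : Submodule K X, (Y.map X.subtype).comap X.subtype = Y := fun Y =>
    Submodule.comap_map_eq_of_injective X.subtype_injective Y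
  refine ⟨fun h => hX ?_, fun Y hY => ?_⟩
  · intro x hx
    have hmem : (⟨x, hx⟩ : X) ∈ H.comap X.subtype := h ▸ Submodule.mem_top
    exact hmem
  · obtain ⟨hle, y, hyY, hyH⟩ := SetLike.lt_iff_le_and_exists.mp hY
    have hlt : H < H ⊔ Y.map X.subtype := by
      refine lt_of_le_of_ne le_sup_left fun h => hyH ?_
      have hy : X.subtype y ∈ H := by
        rw [h]
        exact Submodule.mem_sup_right (Submodule.mem_map_of_mem hyY)
      exact hy
    have htop := hH.2 _ hlt
    refine eq_top_iff.mpr fun x _ => ?_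
    have hx : (x : V) ∈ H ⊔ Y.map X.subtype := htop ▸ Submodule.mem_top
    obtain ⟨h, hh, w, hw, hsum⟩ := Submodule.mem_sup.mp hx
    obtain ⟨y', hy', rfl⟩ := hw
    have hxy : x - y' ∈ Y := hle (by
      have he : X.subtype (x - y') = h := by
        simp only [map_sub, Submodule.subtype_apply, ← hsum]
        abel
      rw [Submodule.mem_comap, he]
      exact hh)
    have := Y.add_mem hxy hy'
    simpa using this

/-- The restriction `A^X = {H ∩ X | H ∈ A, X ⊄ H}`, an arrangement in the vector space `X`. -/
def restrict (A : CentralArrangement K V) (X : Submodule K V) : CentralArrangement K X where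
  hyperplanes := {W | ∃ H ∈ A.hyperplanes, ¬ X ≤ H ∧ W = H.comap X.subtype}
  finite := (A.finite.image fun H => H.comap X.subtype).subset (by
    rintro W ⟨H, hH, -, rfl⟩
    exact ⟨H, hH, rfl⟩)
  isCoatom := by
    rintro W ⟨H, hH, hX, rfl⟩
    exact isCoatom_comap_subtype (A.isCoatom H hH) hX

/-- The intersection lattice `L(A)`: all intersections of subsets of `A`
(the empty intersection is `V`). -/
def flats (A : CentralArrangement K V) : Set (Submodule K V) :=
  {X | ∃ B ⊆ A.hyperplanes, X = sInf B}

/-- A linear form `α_H` with kernel `H` (unique up to a nonzero scalar for a hyperplane `H`). -/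
noncomputable def definingForm (H : Submodule K V) : Module.Dual K V :=
  Classical.epsilon fun α => LinearMap.ker α = H

theorem ker_definingForm {H : Submodule K V} (hH : IsCoatom H) :
    LinearMap.ker (definingForm H) = H := by
  refine Classical.epsilon_spec (p := fun α : Module.Dual K V => LinearMap.ker α = H) ?_
  obtain ⟨f, hf, hle⟩ := Submodule.exists_le_ker_of_lt_top H hH.lt_top
  refine ⟨f, ?_⟩
  rcases hle.eq_or_lt with h | h
  · exact h.symm
  · exact absurd (LinearMap.ker_eq_top.mp (hH.2 _ h)) hf

/-- A linear form on `V` as a linear polynomial in the coordinates `x_i` with respect to the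
basis `b`. -/
noncomputable def formPoly {l : ℕ} (b : Module.Basis (Fin l) K V) (α : Module.Dual K V) :
    MvPolynomial (Fin l) K :=
  ∑ i, MvPolynomial.C (α (b i)) * MvPolynomial.X i

/-- The defining polynomial `Q(A) = ∏ α_H`, in the coordinates given by the basis `b`. -/
noncomputable def definingPoly {l : ℕ} (b : Module.Basis (Fin l) K V)
    (A : CentralArrangement K V) : MvPolynomial (Fin l) K :=
  ∏ H ∈ A.finite.toFinset, formPoly b (definingForm H)

/-- The module `D(A)` of `A`-derivations `θ` of `S = K[x_1, …, x_l]`: `θ(Q(A)) ∈ Q(A) S`. -/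
noncomputable def logDer {l : ℕ} (b : Module.Basis (Fin l) K V) (A : CentralArrangement K V) :
    Submodule (MvPolynomial (Fin l) K)
      (Derivation K (MvPolynomial (Fin l) K) (MvPolynomial (Fin l) K)) where
  carrier := {θ | definingPoly b A ∣ θ (definingPoly b A)}
  zero_mem' := by simp
  add_mem' := fun h₁ h₂ => by
    simpa using dvd_add h₁ h₂
  smul_mem' := fun c θ h => by
    simpa using Dvd.dvd.mul_left h c

/-- `A` is free with multiset of exponents `e`: the `S`-module `D(A)` has a basis of homogeneous
derivations whose degrees form `e`. The choice of linear coordinates on `V` is immaterial. -/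
def IsFreeWithExponents (A : CentralArrangement K V) (e : Multiset ℕ) : Prop :=
  ∃ (l : ℕ) (b : Module.Basis (Fin l) K V)
    (θ : Module.Basis (Fin l) (MvPolynomial (Fin l) K) (logDer b A)) (d : Fin l → ℕ),
    (∀ i j, ((θ i).1 (MvPolynomial.X j)).IsHomogeneous (d i)) ∧
      e = Finset.univ.val.map d

end Basic

/-- The class of inductively free arrangements: the smallest class that contains the empty
arrangements and that contains `A` as soon as, for some `H ∈ A`, both `A' = A ∖ {H}` and
`A'' = A^H` belong to it and `exp(A'') ⊆ exp(A')`. -/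
inductive IsInductivelyFree {K : Type*} [Field K] :
    ∀ {V : Type u} [AddCommGroup V] [Module K V], CentralArrangement K V → Prop
  | empty (V : Type u) [AddCommGroup V] [Module K V] [FiniteDimensional K V] :
      IsInductivelyFree (CentralArrangement.empty K V)
  | add {V : Type u} [AddCommGroup V] [Module K V] (A : CentralArrangement K V)
      (H : Submodule K V) (hH : H ∈ A.hyperplanes) (e' e'' : Multiset ℕ)
      (hrestrict : IsInductivelyFree (A.restrict H)) (hdelete : IsInductivelyFree (A.delete H))
      (hexp'' : (A.restrict H).IsFreeWithExponents e'')
      (hexp' : (A.delete H).IsFreeWithExponents e') (hle : e'' ≤ e') :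
      IsInductivelyFree A

section Accuracy

variable {K : Type*} {V : Type u} [Field K] [AddCommGroup V] [Module K V]

/-- `(X_1, …, X_l)`, with `l = dim V`, is a witness for the flag-accuracy of `A`: `A` is free with
exponents `e_1 ≤ … ≤ e_l`, each `X_d` is a flat of dimension `d` such that `A^{X_d}` is free with
exponents `e_1, …, e_d`, and `X_1 ⊆ X_2 ⊆ … ⊆ X_l`. Only the values `X d`, `1 ≤ d ≤ l`, matter. -/
def IsFlagAccuracyWitness (A : CentralArrangement K V) (X : ℕ → Submodule K V) : Prop :=
  ∃ e : List ℕ, e.Pairwise (· ≤ ·) ∧ A.IsFreeWithExponents (e : Multiset ℕ) ∧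
    (∀ d, 1 ≤ d → d ≤ Module.finrank K V →
      X d ∈ A.flats ∧ Module.finrank K (X d) = d ∧
        (A.restrict (X d)).IsFreeWithExponents (e.take d : Multiset ℕ)) ∧
    ∀ d, 1 ≤ d → d + 1 ≤ Module.finrank K V → X d ≤ X (d + 1)

/-- `A` is flag-accurate. -/
def IsFlagAccurate (A : CentralArrangement K V) : Prop :=
  ∃ X : ℕ → Submodule K V, A.IsFlagAccuracyWitness X

/-- `A` is ind-flag-accurate: it is inductively free and flag-accurate, with a witness all of whose
restrictions `A^{X_d}` are inductively free. -/
def IsIndFlagAccurate (A : CentralArrangement K V) : Prop :=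
  A.IsInductivelyFree ∧ A.IsFlagAccurate ∧
    ∃ X : ℕ → Submodule K V, A.IsFlagAccuracyWitness X ∧
      ∀ d, 1 ≤ d → d ≤ Module.finrank K V → (A.restrict (X d)).IsInductivelyFree

end Accuracy

end CentralArrangement

section Affine

variable {K : Type*} {V : Type*} [Field K] [AddCommGroup V] [Module K V]

/-- The affine subspace `{v | φ v = c}`, a hyperplane if `φ ≠ 0`. -/
def affineHyperplane (φ : Module.Dual K V) (c : K) : AffineSubspace K V where
  carrier := {v | φ v = c}
  smul_vsub_vadd_mem' := by
    intro t p₁ p₂ p₃ h₁ h₂ h₃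
    simp only [Set.mem_ofPred_eq] at *
    simp [h₁, h₂, h₃]

theorem affineHyperplane_eq_cases {φ ψ : Module.Dual K V} {c d : K} (hφ : φ ≠ 0)
    (h : affineHyperplane φ c = affineHyperplane ψ d) : ∃ t : K, ψ = t • φ ∧ d = t * c := by
  have hm : ∀ v, φ v = c ↔ ψ v = d := fun v => by
    have := congrArg (fun s : AffineSubspace K V => v ∈ s) h
    exact iff_of_eq this
  obtain ⟨w, hw⟩ : ∃ w, φ w ≠ 0 := by
    by_contra! hcon
    exact hφ (LinearMap.ext hcon)
  set u := (φ w)⁻¹ • w with hu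
  have hu1 : φ u = 1 := by simp [hu, hw]
  have h0 : ψ (c • u) = d := (hm _).1 (by simp [hu1])
  refine ⟨ψ u, ?_, ?_⟩
  · ext v
    have h1 : ψ (v + (c - φ v) • u) = d := (hm _).1 (by simp [hu1])
    simp only [map_add, map_smul, smul_eq_mul, LinearMap.smul_apply] at h0 h1 ⊢
    linear_combination h1 - h0
  · simp only [map_smul, smul_eq_mul] at h0
    rw [← h0, mul_comm]

end Affine

/-- A (not necessarily central) hyperplane arrangement in `V`: a finite set of affine
hyperplanes. -/
@[ext]
structure AffineArrangement (K : Type*) (V : Type*) [Field K] [AddCommGroup V] [Module K V] where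
  /-- the hyperplanes of the arrangement -/
  hyperplanes : Set (AffineSubspace K V)
  finite : hyperplanes.Finite
  isHyperplane : ∀ H ∈ hyperplanes, ∃ φ : Module.Dual K V, φ ≠ 0 ∧
    ∃ c : K, H = affineHyperplane φ c

/-- The hyperplane `φ(x) = c z` of `V × K`, where `z` is the last coordinate: the homogenization
of the equation `φ(x) = c`. -/
def homogenizedHyperplane {K : Type*} {V : Type*} [Field K] [AddCommGroup V] [Module K V]
    (φ : Module.Dual K V) (c : K) : Submodule K (V × K) :=
  LinearMap.ker (φ ∘ₗ LinearMap.fst K V K - c • LinearMap.snd K V K)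

theorem isCoatom_ker_of_ne_zero {K : Type*} {W : Type*} [Field K] [AddCommGroup W] [Module K W]
    {f : Module.Dual K W} (hf : f ≠ 0) : IsCoatom (LinearMap.ker f) :=
  LinearMap.isCoatom_ker_of_surjective (LinearMap.surjective hf)

/-- The cone over an affine arrangement: the central arrangement in `V × K` that consists of the
hyperplane at infinity `z = 0` and of the hyperplanes `φ(x) = c z`, one for each hyperplane
`φ(x) = c` of the arrangement. -/
def AffineArrangement.cone {K : Type*} {V : Type*} [Field K] [AddCommGroup V] [Module K V]
    (A : AffineArrangement K V) : CentralArrangement K (V × K) where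
  hyperplanes := insert (LinearMap.ker (LinearMap.snd K V K))
    {W | ∃ (φ : Module.Dual K V) (c : K), φ ≠ 0 ∧ affineHyperplane φ c ∈ A.hyperplanes ∧
      W = homogenizedHyperplane φ c}
  finite := by
    refine Set.Finite.insert _ ?_
    classical
    choose! φ hφ c hc using A.isHyperplane
    refine (A.finite.image fun H => homogenizedHyperplane (φ H) (c H)).subset ?_
    rintro W ⟨ψ, d, hψ, hmem, rfl⟩
    refine ⟨_, hmem, ?_⟩
    have hφ' := hφ _ hmem
    have hc' := hc _ hmem
    simp only
    generalize φ (affineHyperplane ψ d) = φ' at hφ' hc' ⊢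
    generalize c (affineHyperplane ψ d) = c' at hφ' hc' ⊢
    obtain ⟨t, ht, htd⟩ := affineHyperplane_eq_cases hφ' hc'.symm
    have ht0 : t ≠ 0 := by
      rintro rfl
      exact hψ (by rw [ht, zero_smul])
    subst ht htd
    ext ⟨v, z⟩
    simp only [homogenizedHyperplane, LinearMap.mem_ker, LinearMap.sub_apply,
      LinearMap.comp_apply, LinearMap.fst_apply, LinearMap.smul_apply, LinearMap.snd_apply,
      smul_eq_mul]
    rw [mul_assoc, ← mul_sub, mul_eq_zero, or_iff_right ht0]
  isCoatom := by
    rintro W (rfl | ⟨φ, c, hφ, -, rfl⟩)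
    · refine isCoatom_ker_of_ne_zero fun h => ?_
      simpa using LinearMap.congr_fun h (0, 1)
    · refine isCoatom_ker_of_ne_zero fun h => hφ (LinearMap.ext fun v => ?_)
      simpa using LinearMap.congr_fun h (v, 0)

section Families

/-- The coordinate function `x_i` on `ℝ^l` (indices start at `0`). -/
def coordForm {l : ℕ} (i : Fin l) : Module.Dual ℝ (Fin l → ℝ) := LinearMap.proj i

theorem coordForm_ne_zero {l : ℕ} (i : Fin l) : coordForm i ≠ 0 := fun h => by
  simpa [coordForm] using LinearMap.congr_fun h (Pi.single i 1)

theorem coordForm_sub_ne_zero {l : ℕ} {i j : Fin l} (hij : i ≠ j) :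
    coordForm i - coordForm j ≠ 0 := fun h => by
  simpa [coordForm, hij.symm] using LinearMap.congr_fun h (Pi.single i 1)

/-- The arrangement in `ℝ^l` with the hyperplanes `x_i - x_j = c` for `i ≠ j` and `c ∈ D i j`, and
`x_i = c` for `c ∈ N i`. -/
def deformation {l : ℕ} (D : Fin l → Fin l → Finset ℤ) (N : Fin l → Finset ℤ) :
    AffineArrangement ℝ (Fin l → ℝ) where
  hyperplanes :=
    {H | ∃ i j, i ≠ j ∧ ∃ c ∈ D i j, H = affineHyperplane (coordForm i - coordForm j) (c : ℝ)} ∪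
    {H | ∃ i, ∃ c ∈ N i, H = affineHyperplane (coordForm i) (c : ℝ)}
  finite := by
    refine Set.Finite.union ?_ ?_
    · refine (Set.finite_iUnion fun i => Set.finite_iUnion fun j =>
        ((D i j).finite_toSet.image fun c : ℤ =>
          affineHyperplane (coordForm i - coordForm j) (c : ℝ))).subset ?_
      rintro H ⟨i, j, -, c, hc, rfl⟩
      exact Set.mem_iUnion.mpr ⟨i, Set.mem_iUnion.mpr ⟨j, c, hc, rfl⟩⟩
    · refine (Set.finite_iUnion fun i => ((N i).finite_toSet.image fun c : ℤ =>
          affineHyperplane (coordForm i) (c : ℝ))).subset ?_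
      rintro H ⟨i, c, hc, rfl⟩
      exact Set.mem_iUnion.mpr ⟨i, c, hc, rfl⟩
  isHyperplane := by
    rintro H (⟨i, j, hij, c, -, rfl⟩ | ⟨i, c, -, rfl⟩)
    · exact ⟨_, coordForm_sub_ne_zero hij, _, rfl⟩
    · exact ⟨_, coordForm_ne_zero i, _, rfl⟩

/-- The arrangement `H^p_l(m, a, n)` in `ℝ^l`: `x_i - x_j ∈ [1-a, a]` for `i < j`,
`x_i ∈ [-m, na-1]` for the first `p` indices `i`, `x_i ∈ [-m-1, na-1]` for the others. -/
noncomputable def shiLike (l p m a n : ℕ) : AffineArrangement ℝ (Fin l → ℝ) :=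
  deformation
    (fun i j => if i < j then Finset.Icc (1 - (a : ℤ)) a else ∅)
    (fun i => if i.val < p then Finset.Icc (-(m : ℤ)) (n * a - 1)
      else Finset.Icc (-(m : ℤ) - 1) (n * a - 1))

open Classical in
/-- The `ψ`-digraphic arrangement `A(G, ψ)` in `ℝ^l`: `x_i - x_j = 0` for `i < j`,
`x_i - x_j = 1` for the edges `(i, j)` of `G`, and `x_i = c` for `c ∈ ψ(i)`. -/
noncomputable def digraphic {l : ℕ} (G : Digraph (Fin l)) (ψ : Fin l → Finset ℤ) :
    AffineArrangement ℝ (Fin l → ℝ) :=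
  deformation
    (fun i j => (if i < j then {0} else ∅) ∪ (if G.Adj i j then {1} else ∅)) ψ

/-- The digraph `T^k_l`, with the edges `(i, j)`, `1 ≤ i < j ≤ l - k + 1`
(vertices numbered from `1`). -/
def shiDigraph (l k : ℕ) : Digraph (Fin l) where
  Adj i j := i < j ∧ (j.val + 1) + k ≤ l + 1

/-- The weight `ψ^{p,k}_l` with parameters `m, d`: for a vertex `i`, numbered from `1`, it is
`[1 - min(l-i+1, k) - m, d]` if `i ≤ p` and `[-min(l-i+1, k) - m, d]` if `i > p`. -/
noncomputable def shiWeight (l p k m d : ℕ) (v : Fin l) : Finset ℤ :=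
  let i : ℤ := v.val + 1
  if i ≤ p then Finset.Icc (1 - min (l - i + 1) (k : ℤ) - m) d
  else Finset.Icc (-min (l - i + 1) (k : ℤ) - m) d

/-- The arrangement `A^{p,k}_l(m, d)` of the Shi descendant matrix. Its `p`-th row is a Shi
descendant sequence, with origin `A^{p,1}_l(m, d)`. -/
noncomputable def shiDescendant (l p k m d : ℕ) : AffineArrangement ℝ (Fin l → ℝ) :=
  digraphic (shiDigraph l k) (shiWeight l p k m d)

/-- The space `{x ∈ ℝ^{l+1} | ∑ x_i = 0}`, which carries the root system of type `A_l`. -/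
def typeASpace (l : ℕ) : Submodule ℝ (Fin (l + 1) → ℝ) :=
  LinearMap.ker (∑ i, coordForm i)

/-- The linear form `x_i - x_j` on `typeASpace l`: a positive root of type `A_l` if `i < j`. -/
def rootForm {l : ℕ} (i j : Fin (l + 1)) : Module.Dual ℝ (typeASpace l) :=
  (coordForm i - coordForm j) ∘ₗ (typeASpace l).subtype

theorem rootForm_ne_zero {l : ℕ} {i j : Fin (l + 1)} (hij : i < j) : rootForm i j ≠ 0 := fun h => by
  have hne : i ≠ j := hij.ne
  have hmem : (Pi.single i 1 - Pi.single j 1 : Fin (l + 1) → ℝ) ∈ typeASpace l := by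
    simp [typeASpace, coordForm]
  have h1 := LinearMap.congr_fun h ⟨_, hmem⟩
  simp [rootForm, coordForm, hne, hne.symm] at h1

/-- The extended Shi arrangement `Shi^m(A_l)`: the hyperplanes `α = k` for the positive roots `α`
of type `A_l` and the integers `1 - m ≤ k ≤ m`. -/
def extendedShiA (l m : ℕ) : AffineArrangement ℝ (typeASpace l) where
  hyperplanes := {H | ∃ i j : Fin (l + 1), i < j ∧ ∃ k ∈ Finset.Icc (1 - (m : ℤ)) m,
    H = affineHyperplane (rootForm i j) (k : ℝ)}
  finite := by
    refine (Set.finite_iUnion fun i : Fin (l + 1) => Set.finite_iUnion fun j : Fin (l + 1) =>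
      ((Finset.Icc (1 - (m : ℤ)) m).finite_toSet.image fun c : ℤ =>
        affineHyperplane (rootForm i j) (c : ℝ))).subset ?_
    rintro H ⟨i, j, -, c, hc, rfl⟩
    exact Set.mem_iUnion.mpr ⟨i, Set.mem_iUnion.mpr ⟨j, c, hc, rfl⟩⟩
  isHyperplane := by
    rintro H ⟨i, j, hij, k, -, rfl⟩
    exact ⟨_, rootForm_ne_zero hij, _, rfl⟩

end Families

namespace MvPolynomial

variable {σ R : Type*} [CommSemiring R]

theorem homogeneousComponent_mul_of_isHomogeneous (f : MvPolynomial σ R) {g : MvPolynomial σ R}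
    {m : ℕ} (hg : g.IsHomogeneous m) (n : ℕ) :
    homogeneousComponent n (f * g) =
      if m ≤ n then homogeneousComponent (n - m) f * g else 0 := by
  have h1 : f * g = ∑ i ∈ Finset.range (f.totalDegree + 1), homogeneousComponent i f * g := by
    rw [← Finset.sum_mul, sum_homogeneousComponent]
  have h2 : ∀ i, homogeneousComponent n (homogeneousComponent i f * g) =
      if i + m = n then homogeneousComponent i f * g else 0 := fun i => by
    rw [homogeneousComponent_of_mem (m := n)
      ((mem_homogeneousSubmodule _ _).2 ((homogeneousComponent_isHomogeneous i f).mul hg))]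
    simp only [eq_comm]
  rw [h1, map_sum, Finset.sum_congr rfl fun i _ => h2 i]
  split_ifs with hmn
  · rw [Finset.sum_congr rfl (g := fun i => if i = n - m then homogeneousComponent i f * g else 0)
      fun i _ => if_congr (by omega) rfl rfl, Finset.sum_ite_eq']
    split_ifs with hr
    · rfl
    · rw [homogeneousComponent_eq_zero _ _ (by simp at hr; omega), zero_mul]
  · exact Finset.sum_eq_zero fun i _ => if_neg (by omega)

end MvPolynomial

theorem Derivation.leibniz_prod {R A ι : Type*} [CommSemiring R] [CommSemiring A] [Algebra R A]
    [DecidableEq ι] (D : Derivation R A A) (s : Finset ι) (f : ι → A) :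
    D (∏ i ∈ s, f i) = ∑ i ∈ s, (∏ j ∈ s.erase i, f j) • D (f i) := by
  induction s using Finset.induction_on with
  | empty => simp
  | insert a s ha ih =>
    rw [Finset.prod_insert ha, D.leibniz, ih, Finset.sum_insert ha, Finset.erase_insert ha,
      add_comm, Finset.smul_sum]
    refine congrArg₂ _ rfl (Finset.sum_congr rfl fun i hi => ?_)
    rw [Finset.erase_insert_of_ne (by rintro rfl; exact ha hi), Finset.prod_insert (by simp [ha]),
      smul_smul]

namespace CentralArrangement

open MvPolynomial

section Forms

variable {K : Type*} [Field K] {V W : Type*} [AddCommGroup V] [Module K V] [AddCommGroup W]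
  [Module K W] {l n : ℕ}

/-- `formPoly` as a linear map. -/
noncomputable def formPolyₗ (b : Module.Basis (Fin l) K V) :
    Module.Dual K V →ₗ[K] MvPolynomial (Fin l) K where
  toFun := formPoly b
  map_add' α β := by simp [formPoly, add_mul, Finset.sum_add_distrib]
  map_smul' t α := by
    simp [formPoly, Finset.smul_sum, MvPolynomial.smul_eq_C_mul, mul_assoc]

theorem formPolyₗ_apply (b : Module.Basis (Fin l) K V) (α : Module.Dual K V) :
    formPolyₗ b α = formPoly b α := rfl

theorem formPoly_add (b : Module.Basis (Fin l) K V) (α β : Module.Dual K V) :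
    formPoly b (α + β) = formPoly b α + formPoly b β := (formPolyₗ b).map_add α β

theorem formPoly_sub (b : Module.Basis (Fin l) K V) (α β : Module.Dual K V) :
    formPoly b (α - β) = formPoly b α - formPoly b β := (formPolyₗ b).map_sub α β

theorem formPoly_smul (b : Module.Basis (Fin l) K V) (t : K) (α : Module.Dual K V) :
    formPoly b (t • α) = t • formPoly b α := (formPolyₗ b).map_smul t α

theorem formPoly_zero (b : Module.Basis (Fin l) K V) : formPoly b (0 : Module.Dual K V) = 0 :=
  (formPolyₗ b).map_zero

theorem formPoly_coord (b : Module.Basis (Fin l) K V) (i : Fin l) :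
    formPoly b (b.coord i) = X i := by
  simp [formPoly, Finsupp.single_apply, apply_ite (C : K → MvPolynomial (Fin l) K)]

theorem isHomogeneous_formPoly (b : Module.Basis (Fin l) K V) (α : Module.Dual K V) :
    (formPoly b α).IsHomogeneous 1 :=
  IsHomogeneous.sum _ _ _ fun _ _ => isHomogeneous_C_mul_X _ _

theorem formPoly_eq_zero_iff (b : Module.Basis (Fin l) K V) {α : Module.Dual K V} :
    formPoly b α = 0 ↔ α = 0 := by
  refine ⟨fun h => b.ext fun i => ?_, fun h => h ▸ formPoly_zero b⟩
  have := congrArg (coeff (Finsupp.single i 1)) h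
  simpa [formPoly, coeff_sum, coeff_C_mul, coeff_X, Finsupp.single_left_inj] using this

theorem dual_eq_sum (b : Module.Basis (Fin l) K V) (β : Module.Dual K V) :
    β = ∑ i, β (b i) • b.coord i :=
  b.ext fun i => by simp

/-- The homomorphism of coordinate rings induced by a linear map. -/
noncomputable def pullbackHom (b : Module.Basis (Fin l) K V) (c : Module.Basis (Fin n) K W)
    (g : W →ₗ[K] V) : MvPolynomial (Fin l) K →ₐ[K] MvPolynomial (Fin n) K :=
  aeval fun i => formPoly c (b.coord i ∘ₗ g)

theorem pullbackHom_formPoly (b : Module.Basis (Fin l) K V) (c : Module.Basis (Fin n) K W)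
    (g : W →ₗ[K] V) (β : Module.Dual K V) :
    pullbackHom b c g (formPoly b β) = formPoly c (β ∘ₗ g) := by
  conv_rhs => rw [dual_eq_sum b β]
  have : ((∑ i, β (b i) • b.coord i) ∘ₗ g) = ∑ i, β (b i) • (b.coord i ∘ₗ g) := by
    ext; simp only [LinearMap.comp_apply, LinearMap.sum_apply, LinearMap.smul_apply]
  rw [this, ← formPolyₗ_apply c, map_sum]
  simp [formPoly, pullbackHom, formPolyₗ_apply, MvPolynomial.smul_eq_C_mul]

theorem pullbackHom_X (b : Module.Basis (Fin l) K V) (c : Module.Basis (Fin n) K W)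
    (g : W →ₗ[K] V) (i : Fin l) :
    pullbackHom b c g (X i) = formPoly c (b.coord i ∘ₗ g) := by
  simp [pullbackHom]

theorem isHomogeneous_pullbackHom (b : Module.Basis (Fin l) K V) (c : Module.Basis (Fin n) K W)
    (g : W →ₗ[K] V) {f : MvPolynomial (Fin l) K} {m : ℕ} (hf : f.IsHomogeneous m) :
    (pullbackHom b c g f).IsHomogeneous m := by
  have := hf.aeval _ (fun i => isHomogeneous_formPoly c (b.coord i ∘ₗ g))
  rwa [one_mul] at this

theorem pullbackHom_pullbackHom_of_comp_eq_id (b : Module.Basis (Fin l) K V)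
    (c : Module.Basis (Fin n) K W) {g : W →ₗ[K] V} {π : V →ₗ[K] W} (h : π ∘ₗ g = LinearMap.id)
    (f : MvPolynomial (Fin n) K) : pullbackHom b c g (pullbackHom c b π f) = f := by
  have : (pullbackHom b c g).comp (pullbackHom c b π) = AlgHom.id K _ := by
    refine MvPolynomial.algHom_ext fun i => ?_
    rw [AlgHom.comp_apply, pullbackHom_X, pullbackHom_formPoly, LinearMap.comp_assoc, h,
      LinearMap.comp_id, formPoly_coord, AlgHom.id_apply]
  exact DFunLike.congr_fun this f

theorem exists_eq_smul_of_ker_le {α β : Module.Dual K V}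
    (h : LinearMap.ker α ≤ LinearMap.ker β) : ∃ t : K, β = t • α := by
  by_cases hα : α = 0
  · subst hα
    refine ⟨0, ?_⟩
    ext v
    simpa using h (show v ∈ LinearMap.ker (0 : Module.Dual K V) by simp)
  obtain ⟨w, hw⟩ : ∃ w, α w ≠ 0 := by
    by_contra! hcon
    exact hα (LinearMap.ext hcon)
  refine ⟨β w / α w, ?_⟩
  ext v
  have h1 : v - (α v / α w) • w ∈ LinearMap.ker α := by simp [hw]
  have h2 := h h1
  simp only [LinearMap.mem_ker, map_sub, map_smul, smul_eq_mul, sub_eq_zero] at h2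
  rw [h2]
  simp only [LinearMap.smul_apply, smul_eq_mul]
  field_simp

theorem pullbackHom_eq_zero_iff (b : Module.Basis (Fin l) K V) (c : Module.Basis (Fin n) K W)
    {g : W →ₗ[K] V} {π : V →ₗ[K] W} (hπ : π ∘ₗ g = LinearMap.id) {α : Module.Dual K V}
    (hα : LinearMap.ker α = LinearMap.range g) (f : MvPolynomial (Fin l) K) :
    pullbackHom b c g f = 0 ↔ formPoly b α ∣ f := by
  constructor
  · intro h
    set I := Ideal.span {formPoly b α}
    have key : (Ideal.Quotient.mkₐ K I).comp ((pullbackHom c b π).comp (pullbackHom b c g)) =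
        Ideal.Quotient.mkₐ K I := by
      refine MvPolynomial.algHom_ext fun i => ?_
      rw [AlgHom.comp_apply, AlgHom.comp_apply, pullbackHom_X, pullbackHom_formPoly]
      refine (Ideal.Quotient.eq.2 ?_)
      rw [← formPoly_coord b, ← formPoly_sub]
      obtain ⟨t, ht⟩ : ∃ t : K, (b.coord i ∘ₗ g) ∘ₗ π - b.coord i = t • α := by
        refine exists_eq_smul_of_ker_le ?_
        rw [hα]
        rintro _ ⟨w, rfl⟩
        have : π (g w) = w := LinearMap.congr_fun hπ w
        simp [this]
      rw [ht, formPoly_smul, MvPolynomial.smul_eq_C_mul]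
      exact I.mul_mem_left _ (Ideal.subset_span rfl)
    have h2 := DFunLike.congr_fun key f
    rw [AlgHom.comp_apply, AlgHom.comp_apply, h, map_zero, map_zero] at h2
    exact Ideal.mem_span_singleton.1 (Ideal.Quotient.eq_zero_iff_mem.1 h2.symm)
  · rintro ⟨q, rfl⟩
    have h0 : α ∘ₗ g = 0 := LinearMap.range_le_ker_iff.1 hα.ge
    rw [map_mul, pullbackHom_formPoly, h0, formPoly_zero, zero_mul]

theorem exists_retraction (H : Submodule K V) : ∃ π : V →ₗ[K] H, π ∘ₗ H.subtype = LinearMap.id :=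
  H.subtype.exists_leftInverse_of_injective H.ker_subtype

theorem prime_formPoly [FiniteDimensional K V] (b : Module.Basis (Fin l) K V)
    {α : Module.Dual K V} (hα : α ≠ 0) : Prime (formPoly b α) := by
  obtain ⟨π, hπ⟩ := exists_retraction (LinearMap.ker α)
  have hk : RingHom.ker (pullbackHom b (Module.finBasis K (LinearMap.ker α))
      (LinearMap.ker α).subtype).toRingHom = Ideal.span {formPoly b α} := by
    ext f
    rw [Ideal.mem_span_singleton]
    exact pullbackHom_eq_zero_iff b _ hπ (by simp) f
  rw [← Ideal.span_singleton_prime ((formPoly_eq_zero_iff b).not.2 hα), ← hk]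
  exact RingHom.ker_isPrime _

theorem ker_le_of_formPoly_dvd [FiniteDimensional K V] (b : Module.Basis (Fin l) K V)
    {α β : Module.Dual K V} (h : formPoly b α ∣ formPoly b β) :
    LinearMap.ker α ≤ LinearMap.ker β := by
  obtain ⟨π, hπ⟩ := exists_retraction (LinearMap.ker α)
  have := (pullbackHom_eq_zero_iff b (Module.finBasis K (LinearMap.ker α)) hπ (by simp) _).2 h
  rw [pullbackHom_formPoly, formPoly_eq_zero_iff] at this
  simpa using LinearMap.range_le_ker_iff.2 this

theorem definingForm_ne_zero {H : Submodule K V} (hH : IsCoatom H) : definingForm H ≠ 0 :=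
  fun h => hH.1 (by rw [← ker_definingForm hH, h, LinearMap.ker_zero])

theorem isRelPrime_formPoly [FiniteDimensional K V] (b : Module.Basis (Fin l) K V)
    {H H' : Submodule K V} (hH : IsCoatom H) (hH' : IsCoatom H') (hne : H ≠ H') :
    IsRelPrime (formPoly b (definingForm H)) (formPoly b (definingForm H')) := by
  refine ((prime_formPoly b (definingForm_ne_zero hH)).irreducible.isRelPrime_iff_not_dvd).2 ?_
  intro h
  have := ker_le_of_formPoly_dvd b h
  rw [ker_definingForm hH, ker_definingForm hH'] at this
  rcases this.eq_or_lt with h | h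
  · exact hne h
  · exact hH'.1 (hH.2 _ h)

/-- A derivation lies in `D(A)` if and only if it maps each form `α_H` to a multiple of `α_H`. -/
theorem mem_logDer_iff [FiniteDimensional K V] (b : Module.Basis (Fin l) K V)
    (A : CentralArrangement K V)
    (θ : Derivation K (MvPolynomial (Fin l) K) (MvPolynomial (Fin l) K)) :
    θ ∈ logDer b A ↔ ∀ H ∈ A.hyperplanes,
      formPoly b (definingForm H) ∣ θ (formPoly b (definingForm H)) := by
  classical
  change definingPoly b A ∣ θ (definingPoly b A) ↔ _
  rw [definingPoly, Derivation.leibniz_prod]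
  constructor
  · intro h H hH
    have hmem : H ∈ A.finite.toFinset := by simpa using hH
    have h1 := (Finset.dvd_prod_of_mem _ hmem).trans h
    rw [← Finset.add_sum_erase _ _ hmem] at h1
    rw [dvd_add_left] at h1
    · rw [smul_eq_mul] at h1
      refine IsRelPrime.dvd_of_dvd_mul_left (IsRelPrime.prod_right fun H' hH' => ?_) h1
      have := Finset.mem_erase.1 hH'
      exact isRelPrime_formPoly b (A.isCoatom H hH) (A.isCoatom H' (by simpa using this.2))
        this.1.symm
    · refine Finset.dvd_sum fun H' hH' => ?_
      rw [smul_eq_mul]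
      have hmem' : H ∈ A.finite.toFinset.erase H' :=
        Finset.mem_erase.2 ⟨(Finset.mem_erase.1 hH').1.symm, hmem⟩
      exact (Finset.dvd_prod_of_mem (fun H => formPoly b (definingForm H)) hmem').mul_right _
  · intro h
    refine Finset.dvd_sum fun H hH => ?_
    rw [← Finset.prod_erase_mul _ _ hH, smul_eq_mul]
    exact mul_dvd_mul_left _ (h H (by simpa using hH))

end Forms

end CentralArrangement

namespace CentralArrangement

open MvPolynomial

section Restriction

variable {K : Type*} [Field K] {V : Type*} [AddCommGroup V] [Module K V] {l n : ℕ}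

theorem exists_restricted_form_eq {H H' : Submodule K V} (hH' : IsCoatom H') (hle : ¬ H ≤ H') :
    ∃ t : K, t ≠ 0 ∧ definingForm H' ∘ₗ H.subtype =
      t • definingForm (H'.comap H.subtype) := by
  have hX := isCoatom_comap_subtype hH' hle
  have hk : LinearMap.ker (definingForm H' ∘ₗ H.subtype) = H'.comap H.subtype := by
    rw [LinearMap.ker_comp, ker_definingForm hH']
  obtain ⟨t, ht⟩ := exists_eq_smul_of_ker_le (α := definingForm (H'.comap H.subtype))
    (β := definingForm H' ∘ₗ H.subtype) (by rw [hk, ker_definingForm hX])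
  refine ⟨t, ?_, ht⟩
  rintro rfl
  rw [ht, zero_smul, LinearMap.ker_zero] at hk
  exact hX.1 hk.symm

theorem coatom_not_le {H H' : Submodule K V} (hH : IsCoatom H) (hH' : IsCoatom H') (hne : H' ≠ H) :
    ¬ H ≤ H' := fun h => by
  rcases h.eq_or_lt with h | h
  · exact hne h.symm
  · exact hH'.1 (hH.2 _ h)

/-- If `H'` and `H₁` meet `H` in the same subspace, then `α_{H'}` divides
`θ(α_H) - h α_H`, where `θ(α_{H₁}) = α_{H₁} h`. -/
theorem dvd_sub_mul_of_comap_eq (b : Module.Basis (Fin l) K V) {H H₁ H' : Submodule K V}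
    (hH : IsCoatom H) (hH₁ : IsCoatom H₁) (hH' : IsCoatom H') (h₁ : H₁ ≠ H) (h' : H' ≠ H)
    (hne : H' ≠ H₁) (hX : H'.comap H.subtype = H₁.comap H.subtype)
    (θ : Derivation K (MvPolynomial (Fin l) K) (MvPolynomial (Fin l) K))
    {h : MvPolynomial (Fin l) K}
    (hθ₁ : θ (formPoly b (definingForm H₁)) = formPoly b (definingForm H₁) * h)
    (hθ' : formPoly b (definingForm H') ∣ θ (formPoly b (definingForm H'))) :
    formPoly b (definingForm H') ∣
      θ (formPoly b (definingForm H)) - h * formPoly b (definingForm H) := by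
  obtain ⟨t₁, ht₁, e₁⟩ := exists_restricted_form_eq hH₁ (coatom_not_le hH hH₁ h₁)
  obtain ⟨t', ht', e'⟩ := exists_restricted_form_eq hH' (coatom_not_le hH hH' h')
  set u := t' / t₁ with hu
  obtain ⟨v, hv⟩ : ∃ v : K, definingForm H' - u • definingForm H₁ = v • definingForm H := by
    refine exists_eq_smul_of_ker_le ?_
    rw [ker_definingForm hH]
    intro w hw
    have a1 := LinearMap.congr_fun e₁ ⟨w, hw⟩
    have a2 := LinearMap.congr_fun e' ⟨w, hw⟩
    rw [hX] at a2
    simp only [LinearMap.comp_apply, Submodule.subtype_apply, LinearMap.smul_apply,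
      smul_eq_mul] at a1 a2
    simp only [LinearMap.mem_ker, LinearMap.sub_apply, LinearMap.smul_apply, smul_eq_mul, a1, a2, hu]
    field_simp
    ring
  have hv0 : v ≠ 0 := by
    rintro rfl
    rw [zero_smul, sub_eq_zero] at hv
    refine coatom_not_le hH₁ hH' hne ?_
    rw [← ker_definingForm hH', hv]
    intro w hw
    rw [← ker_definingForm hH₁, LinearMap.mem_ker] at hw
    simp [hw]
  have hform : formPoly b (definingForm H') =
      u • formPoly b (definingForm H₁) + v • formPoly b (definingForm H) := by
    rw [← formPoly_smul, ← formPoly_smul, ← formPoly_add, ← hv]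
    congr 1
    abel
  have hsum : θ (formPoly b (definingForm H')) = h * formPoly b (definingForm H') +
      C v * (θ (formPoly b (definingForm H)) - h * formPoly b (definingForm H)) := by
    rw [hform, map_add, Derivation.map_smul, Derivation.map_smul, hθ₁]
    simp only [MvPolynomial.smul_eq_C_mul]
    ring
  rw [hsum, dvd_add_right (dvd_mul_left _ _)] at hθ'
  have hunit : IsUnit (C v : MvPolynomial (Fin l) K) := (isUnit_iff_ne_zero.2 hv0).map C
  exact (hunit.dvd_mul_left).1 hθ'

variable [FiniteDimensional K V]

/-- There is a homogeneous polynomial `B` of degree `|A'| - |A''|` on `H` which divides the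
restriction of `θ(α_H)` to `H` for all `θ ∈ D(A')`. -/
theorem exists_dvd_apply_definingForm (b : Module.Basis (Fin l) K V) (A : CentralArrangement K V)
    {H : Submodule K V} (hH : H ∈ A.hyperplanes) (c : Module.Basis (Fin n) K H) :
    ∃ (B : MvPolynomial (Fin n) K) (m : ℕ), B ≠ 0 ∧ B.IsHomogeneous m ∧
      m + (A.restrict H).hyperplanes.ncard = (A.delete H).hyperplanes.ncard ∧
      ∀ θ ∈ logDer b (A.delete H),
        B ∣ pullbackHom b c H.subtype (θ (formPoly b (definingForm H))) := by
  classical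
  have hHc := A.isCoatom H hH
  set s' := (A.delete H).finite.toFinset with hs'
  set s'' := (A.restrict H).finite.toFinset with hs''
  have mem' : ∀ H', H' ∈ s' ↔ H' ∈ A.hyperplanes ∧ H' ≠ H := fun H' => by
    simp [hs', delete]
  have mem'' : ∀ X, X ∈ s'' ↔ ∃ H' ∈ s', H'.comap H.subtype = X := fun X => by
    simp only [hs'', Set.Finite.mem_toFinset, restrict, mem']
    constructor
    · rintro ⟨H', h1, h2, rfl⟩
      exact ⟨H', ⟨h1, by rintro rfl; exact h2 le_rfl⟩, rfl⟩
    · rintro ⟨H', ⟨h1, h2⟩, rfl⟩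
      exact ⟨H', h1, coatom_not_le hHc (A.isCoatom _ h1) h2, rfl⟩
  set F : Submodule K H → Finset (Submodule K V) :=
    fun X => s'.filter fun H' => H'.comap H.subtype = X with hF
  have hcoX : ∀ X ∈ s'', IsCoatom X := fun X hX => (A.restrict H).isCoatom X (by simpa [hs''] using hX)
  have hFpos : ∀ X ∈ s'', 0 < (F X).card := fun X hX => by
    obtain ⟨H', h1, h2⟩ := (mem'' X).1 hX
    exact Finset.card_pos.2 ⟨H', by simp [hF, h1, h2]⟩
  have hcard : ∑ X ∈ s'', (F X).card = s'.card :=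
    (Finset.card_eq_sum_card_fiberwise fun H' hH' => (mem'' _).2 ⟨H', hH', rfl⟩).symm
  refine ⟨∏ X ∈ s'', formPoly c (definingForm X) ^ ((F X).card - 1),
    ∑ X ∈ s'', 1 * ((F X).card - 1), ?_, ?_, ?_, ?_⟩
  · exact Finset.prod_ne_zero_iff.2 fun X hX => pow_ne_zero _
      ((formPoly_eq_zero_iff c).not.2 (definingForm_ne_zero (hcoX X hX)))
  · exact IsHomogeneous.prod _ _ _ fun X _ => (isHomogeneous_formPoly _ _).pow _
  · rw [Set.ncard_eq_toFinset_card _ (A.restrict H).finite,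
      Set.ncard_eq_toFinset_card _ (A.delete H).finite, ← hs', ← hs'', ← hcard,
      Finset.card_eq_sum_ones, ← Finset.sum_add_distrib]
    refine Finset.sum_congr rfl fun X hX => ?_
    have := hFpos X hX
    omega
  · intro θ hθ
    rw [mem_logDer_iff] at hθ
    have hθ' : ∀ H' ∈ s', formPoly b (definingForm H') ∣ θ (formPoly b (definingForm H')) :=
      fun H' h => hθ H' (by simpa [hs'] using h)
    refine Finset.prod_dvd_of_isRelPrime ?_ ?_
    · intro X hX Y hY hXY
      exact (isRelPrime_formPoly c (hcoX X hX) (hcoX Y hY) hXY).pow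
    · intro X hX
      obtain ⟨H₁, hF₁⟩ := Finset.card_pos.1 (hFpos X hX)
      have hF₁' := Finset.mem_filter.1 hF₁
      obtain ⟨h, hh⟩ := hθ' H₁ hF₁'.1
      have hdvd : ∏ H' ∈ (F X).erase H₁, formPoly b (definingForm H') ∣
          θ (formPoly b (definingForm H)) - h * formPoly b (definingForm H) := by
        refine Finset.prod_dvd_of_isRelPrime ?_ ?_
        · intro Y hY Z hZ hYZ
          refine isRelPrime_formPoly b (A.isCoatom _ ?_) (A.isCoatom _ ?_) hYZ
          · exact ((mem' Y).1 (Finset.mem_filter.1 (Finset.mem_of_mem_erase hY)).1).1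
          · exact ((mem' Z).1 (Finset.mem_filter.1 (Finset.mem_of_mem_erase hZ)).1).1
        · intro Y hY
          have hY' := Finset.mem_filter.1 (Finset.mem_of_mem_erase hY)
          refine dvd_sub_mul_of_comap_eq b hHc (A.isCoatom _ ((mem' _).1 hF₁'.1).1)
            (A.isCoatom _ ((mem' _).1 hY'.1).1) ((mem' _).1 hF₁'.1).2 ((mem' _).1 hY'.1).2
            (Finset.ne_of_mem_erase hY) (hY'.2.trans hF₁'.2.symm) θ hh (hθ' _ hY'.1)
      have h0 : pullbackHom b c H.subtype (formPoly b (definingForm H)) = 0 := by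
        rw [pullbackHom_formPoly, formPoly_eq_zero_iff]
        exact LinearMap.range_le_ker_iff.1 (by rw [ker_definingForm hHc]; simp)
      have hdvd2 := map_dvd (pullbackHom b c H.subtype) hdvd
      rw [map_sub, map_mul, h0, mul_zero, sub_zero, map_prod] at hdvd2
      refine dvd_trans ?_ hdvd2
      rw [← Finset.card_erase_of_mem hF₁, ← Finset.prod_const]
      refine Finset.prod_dvd_prod_of_dvd _ _ fun Y hY => ?_
      have hY' := Finset.mem_filter.1 (Finset.mem_of_mem_erase hY)
      have hYm := (mem' _).1 hY'.1
      obtain ⟨t, -, ht⟩ := exists_restricted_form_eq (A.isCoatom _ hYm.1)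
        (coatom_not_le hHc (A.isCoatom _ hYm.1) hYm.2)
      rw [pullbackHom_formPoly, ht, hY'.2, formPoly_smul, MvPolynomial.smul_eq_C_mul]
      exact dvd_mul_left _ _

end Restriction

end CentralArrangement

namespace CentralArrangement

open MvPolynomial

section Addition

variable {K : Type*} [Field K] {V : Type*} [AddCommGroup V] [Module K V] {l n : ℕ}

theorem derivation_sum_smul_apply {ι S : Type*} [CommSemiring S] [Algebra K S] (s : Finset ι)
    (g : ι → S) (θ : ι → Derivation K S S) (f : S) :
    (∑ i ∈ s, g i • θ i) f = ∑ i ∈ s, g i * θ i f := by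
  classical
  induction s using Finset.induction_on with
  | empty => simp
  | insert a s ha ih => simp [Finset.sum_insert ha, ih]

theorem derivation_formPoly (b : Module.Basis (Fin l) K V)
    (θ : Derivation K (MvPolynomial (Fin l) K) (MvPolynomial (Fin l) K)) (β : Module.Dual K V) :
    θ (formPoly b β) = ∑ i, C (β (b i)) * θ (X i) := by
  rw [formPoly, map_sum]
  exact Finset.sum_congr rfl fun i _ => by simp

theorem isHomogeneous_derivation_formPoly (b : Module.Basis (Fin l) K V)
    {θ : Derivation K (MvPolynomial (Fin l) K) (MvPolynomial (Fin l) K)} {d : ℕ}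
    (hθ : ∀ i, (θ (X i)).IsHomogeneous d) (β : Module.Dual K V) :
    (θ (formPoly b β)).IsHomogeneous d := by
  rw [derivation_formPoly]
  exact IsHomogeneous.sum _ _ _ fun i _ => (hθ i).C_mul _

/-- The derivation on the coordinate ring of `W` induced by `θ` along `g : W → V` and
`π : V → W`. -/
noncomputable def inducedDerivation {W : Type*} [AddCommGroup W] [Module K W]
    (b : Module.Basis (Fin l) K V) (c : Module.Basis (Fin n) K W) (g : W →ₗ[K] V) (π : V →ₗ[K] W)
    (θ : Derivation K (MvPolynomial (Fin l) K) (MvPolynomial (Fin l) K)) :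
    Derivation K (MvPolynomial (Fin n) K) (MvPolynomial (Fin n) K) :=
  mkDerivation K fun j => pullbackHom b c g (θ (formPoly b (c.coord j ∘ₗ π)))

theorem inducedDerivation_formPoly {W : Type*} [AddCommGroup W] [Module K W]
    (b : Module.Basis (Fin l) K V) (c : Module.Basis (Fin n) K W) {g : W →ₗ[K] V} {π : V →ₗ[K] W}
    (hπ : π ∘ₗ g = LinearMap.id) {α : Module.Dual K V} (hα : LinearMap.ker α = LinearMap.range g)
    {θ : Derivation K (MvPolynomial (Fin l) K) (MvPolynomial (Fin l) K)}
    (hθ : pullbackHom b c g (θ (formPoly b α)) = 0) (β : Module.Dual K V) :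
    inducedDerivation b c g π θ (formPoly c (β ∘ₗ g)) = pullbackHom b c g (θ (formPoly b β)) := by
  obtain ⟨t, ht⟩ : ∃ t : K, β - (β ∘ₗ g) ∘ₗ π = t • α := by
    refine exists_eq_smul_of_ker_le ?_
    rw [hα]
    rintro _ ⟨w, rfl⟩
    have : π (g w) = w := LinearMap.congr_fun hπ w
    simp [this]
  have h1 : inducedDerivation b c g π θ (formPoly c (β ∘ₗ g)) =
      pullbackHom b c g (θ (formPoly b ((β ∘ₗ g) ∘ₗ π))) := by
    have h2 : (β ∘ₗ g) ∘ₗ π = ∑ j, (β (g (c j))) • (c.coord j ∘ₗ π) := by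
      conv_lhs => rw [dual_eq_sum c (β ∘ₗ g)]
      ext
      simp only [LinearMap.comp_apply, LinearMap.sum_apply, LinearMap.smul_apply]
    rw [h2, derivation_formPoly, ← formPolyₗ_apply b, map_sum, map_sum, map_sum]
    refine Finset.sum_congr rfl fun j _ => ?_
    rw [map_smul, Derivation.map_smul, map_smul, inducedDerivation, mkDerivation_X,
      MvPolynomial.smul_eq_C_mul]
    rfl
  have h0 : pullbackHom b c g (θ (formPoly b (β - (β ∘ₗ g) ∘ₗ π))) = 0 := by
    rw [ht, formPoly_smul, Derivation.map_smul, map_smul, hθ, smul_zero]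
  rw [formPoly_sub, map_sub, map_sub, sub_eq_zero] at h0
  rw [h1, h0]

theorem exists_relation_of_card_lt {S ι κ : Type*} [CommRing S] [IsDomain S] [Fintype ι]
    [Fintype κ] (c : ι → κ → S) (h : Fintype.card κ < Fintype.card ι) :
    ∃ g : ι → S, g ≠ 0 ∧ ∀ j, ∑ i, g i * c i j = 0 := by
  have hdep : ¬ LinearIndependent S c := fun hc => by
    have := hc.fintype_card_le_finrank
    rw [Module.finrank_fintype_fun_eq_card] at this
    omega
  obtain ⟨g, hg, i, hi⟩ := Fintype.not_linearIndependent_iff.1 hdep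
  refine ⟨g, fun h0 => hi (by simp [h0]), fun j => ?_⟩
  simpa using congrFun hg j

theorem exists_basis_submodule {S M : Type*} [CommRing S] [AddCommGroup M] [Module S M]
    (N : Submodule S M) (θ : Fin l → M) (hmem : ∀ i, θ i ∈ N)
    (hli : ∀ g : Fin l → S, ∑ i, g i • θ i = 0 → g = 0)
    (hsp : ∀ η ∈ N, ∃ g : Fin l → S, η = ∑ i, g i • θ i) :
    ∃ B : Module.Basis (Fin l) S N, ∀ i, (B i : M) = θ i := by
  have hli' : LinearIndependent S fun i => (⟨θ i, hmem i⟩ : N) := by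
    refine Fintype.linearIndependent_iff.2 fun g hg i => ?_
    have := congrArg Subtype.val hg
    simp only [Submodule.coe_sum, Submodule.coe_smul, Submodule.coe_zero] at this
    exact congrFun (hli g this) i
  have hsp' : ⊤ ≤ Submodule.span S (Set.range fun i => (⟨θ i, hmem i⟩ : N)) := by
    rintro ⟨η, hη⟩ -
    obtain ⟨g, hg⟩ := hsp η hη
    have : (⟨η, hη⟩ : N) = ∑ i, g i • (⟨θ i, hmem i⟩ : N) := Subtype.ext (by simpa using hg)
    rw [this]
    exact Submodule.sum_mem _ fun i _ => Submodule.smul_mem _ _ (Submodule.subset_span ⟨i, rfl⟩)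
  exact ⟨Module.Basis.mk hli' hsp', fun i => by simp⟩

/-- The module `D(A)` has a homogeneous basis, in the coordinates given by `b`, whose degrees
form `e`. -/
def HasHomogeneousBasis (b : Module.Basis (Fin l) K V) (A : CentralArrangement K V)
    (e : Multiset ℕ) : Prop :=
  ∃ (θ : Fin l → Derivation K (MvPolynomial (Fin l) K) (MvPolynomial (Fin l) K)) (d : Fin l → ℕ),
    (∀ i j, (θ i (X j)).IsHomogeneous (d i)) ∧ (∀ i, θ i ∈ logDer b A) ∧
    (∀ g : Fin l → MvPolynomial (Fin l) K, ∑ i, g i • θ i = 0 → g = 0) ∧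
    (∀ η ∈ logDer b A, ∃ g : Fin l → MvPolynomial (Fin l) K, η = ∑ i, g i • θ i) ∧
    e = Finset.univ.val.map d

theorem HasHomogeneousBasis.isFreeWithExponents {b : Module.Basis (Fin l) K V}
    {A : CentralArrangement K V} {e : Multiset ℕ} (h : HasHomogeneousBasis b A e) :
    A.IsFreeWithExponents e := by
  obtain ⟨θ, d, hd, hmem, hli, hsp, he⟩ := h
  obtain ⟨B, hB⟩ := exists_basis_submodule (logDer b A) θ hmem hli hsp
  exact ⟨l, b, B, d, fun i j => by rw [hB]; exact hd i j, he⟩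

theorem hasHomogeneousBasis_empty (b : Module.Basis (Fin l) K V) :
    HasHomogeneousBasis b (empty K V) (Multiset.replicate (Module.finrank K V) 0) := by
  classical
  refine ⟨fun i => mkDerivation K (Pi.single i 1), fun _ => 0, fun i j => ?_, fun i => ?_,
    fun g hg => ?_, fun η _ => ⟨fun i => η (X i), ?_⟩, ?_⟩
  · rw [mkDerivation_X, Pi.single_apply]
    split_ifs
    · exact isHomogeneous_one _ _
    · exact isHomogeneous_zero _ _ _
  · change definingPoly b (empty K V) ∣ _
    have : definingPoly b (empty K V) = 1 := by simp [definingPoly, empty]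
    rw [this]
    exact one_dvd _
  · ext1 j
    have := DFunLike.congr_fun hg (X j)
    simpa [derivation_sum_smul_apply, mkDerivation_X, Pi.single_apply] using this
  · refine derivation_ext fun j => ?_
    simp [derivation_sum_smul_apply, mkDerivation_X, Pi.single_apply]
  · simp [Module.finrank_eq_card_basis b, Multiset.map_const']

theorem mem_logDer_of_delete [FiniteDimensional K V] (b : Module.Basis (Fin l) K V)
    (A : CentralArrangement K V) {H : Submodule K V} (hH : H ∈ A.hyperplanes)
    (θ : Derivation K (MvPolynomial (Fin l) K) (MvPolynomial (Fin l) K)) :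
    θ ∈ logDer b A ↔ θ ∈ logDer b (A.delete H) ∧
      formPoly b (definingForm H) ∣ θ (formPoly b (definingForm H)) := by
  simp only [mem_logDer_iff]
  constructor
  · exact fun h => ⟨fun H' h' => h H' h'.1, h H hH⟩
  · rintro ⟨h1, h2⟩ H' h'
    by_cases hne : H' = H
    · exact hne ▸ h2
    · exact h1 H' ⟨h', hne⟩

/-- A derivation in `D(A')` which maps `α_H` to a multiple of `α_H` induces an element
of `D(A'')`. -/
theorem inducedDerivation_mem_logDer [FiniteDimensional K V] (b : Module.Basis (Fin l) K V)
    (A : CentralArrangement K V) {H : Submodule K V} (hH : IsCoatom H)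
    (c : Module.Basis (Fin n) K H) {π : V →ₗ[K] H} (hπ : π ∘ₗ H.subtype = LinearMap.id)
    {θ : Derivation K (MvPolynomial (Fin l) K) (MvPolynomial (Fin l) K)}
    (hθ : pullbackHom b c H.subtype (θ (formPoly b (definingForm H))) = 0)
    (hmem : θ ∈ logDer b (A.delete H)) :
    inducedDerivation b c H.subtype π θ ∈ logDer c (A.restrict H) := by
  rw [mem_logDer_iff] at hmem ⊢
  rintro _ ⟨H', hH', hle, rfl⟩
  obtain ⟨t, ht0, ht⟩ := exists_restricted_form_eq (A.isCoatom _ hH') hle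
  have h1 := hmem H' ⟨hH', by rintro rfl; exact hle le_rfl⟩
  have h2 := map_dvd (pullbackHom b c H.subtype) h1
  rw [pullbackHom_formPoly, ← inducedDerivation_formPoly b c hπ
    (by rw [ker_definingForm hH, Submodule.range_subtype]) hθ, ht, formPoly_smul,
    Derivation.map_smul, MvPolynomial.smul_eq_C_mul, MvPolynomial.smul_eq_C_mul] at h2
  have hunit : IsUnit (C t : MvPolynomial (Fin n) K) := (isUnit_iff_ne_zero.2 ht0).map C
  exact (hunit.dvd_mul_left).1 ((hunit.mul_left_dvd).1 h2)

theorem exists_eq_smul_of_forall_dvd (b : Module.Basis (Fin l) K V)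
    {p : MvPolynomial (Fin l) K}
    {ξ : Derivation K (MvPolynomial (Fin l) K) (MvPolynomial (Fin l) K)}
    (h : ∀ β, p ∣ ξ (formPoly b β)) :
    ∃ η : Derivation K (MvPolynomial (Fin l) K) (MvPolynomial (Fin l) K), ξ = p • η := by
  have h' : ∀ i, p ∣ ξ (X i) := fun i => by simpa [formPoly_coord] using h (b.coord i)
  choose q hq using h'
  exact ⟨mkDerivation K q, derivation_ext fun i => by simp [hq, mkDerivation_X]⟩

end Addition

end CentralArrangement

namespace CentralArrangement

open MvPolynomial

section Addition

variable {K : Type*} [Field K] {V : Type*} [AddCommGroup V] [Module K V] {l n : ℕ}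

theorem exists_isHomogeneous_quotient {σ : Type*} {f B : MvPolynomial σ K} {d m : ℕ}
    (hf : f.IsHomogeneous d) (hB : B.IsHomogeneous m) (h : B ∣ f) :
    ∃ q, f = q * B ∧ (d < m → q = 0) ∧ (m ≤ d → q.IsHomogeneous (d - m)) := by
  obtain ⟨q, rfl⟩ := h
  have h1 := homogeneousComponent_mul_of_isHomogeneous q hB d
  rw [mul_comm q B, homogeneousComponent_of_mem ((mem_homogeneousSubmodule _ _).2 hf),
    if_pos rfl] at h1
  refine ⟨if m ≤ d then homogeneousComponent (d - m) q else 0, ?_, fun h => ?_, fun h => ?_⟩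
  · rw [h1]
    split_ifs <;> simp
  · rw [if_neg (by omega)]
  · rw [if_pos h]
    exact homogeneousComponent_isHomogeneous _ _

/-- A homogeneous derivation in the span of homogeneous derivations `η_j` is in the span of those
`η_j` whose degree is at most its own. -/
theorem exists_eq_sum_of_isHomogeneous {ζ : Derivation K (MvPolynomial (Fin n) K)
    (MvPolynomial (Fin n) K)} {η : Fin n → Derivation K (MvPolynomial (Fin n) K)
    (MvPolynomial (Fin n) K)} {d : ℕ} {e : Fin n → ℕ} (hζ : ∀ i, (ζ (X i)).IsHomogeneous d)
    (hη : ∀ j i, (η j (X i)).IsHomogeneous (e j))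
    (h : ∃ g : Fin n → MvPolynomial (Fin n) K, ζ = ∑ j, g j • η j) :
    ∃ g : Fin n → MvPolynomial (Fin n) K, (∀ j, d < e j → g j = 0) ∧ ζ = ∑ j, g j • η j := by
  obtain ⟨g, hg⟩ := h
  refine ⟨fun j => if e j ≤ d then homogeneousComponent (d - e j) (g j) else 0,
    fun j hj => if_neg (by omega), derivation_ext fun i => ?_⟩
  have h1 : ζ (X i) = homogeneousComponent d (ζ (X i)) := by
    rw [homogeneousComponent_of_mem ((mem_homogeneousSubmodule _ _).2 (hζ i)), if_pos rfl]
  rw [h1, hg, derivation_sum_smul_apply, derivation_sum_smul_apply, map_sum]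
  refine Finset.sum_congr rfl fun j _ => ?_
  rw [homogeneousComponent_mul_of_isHomogeneous _ (hη j i)]
  split_ifs <;> simp

theorem card_le_eq_countP {ι : Type*} [Fintype ι] (d : ι → ℕ) (m : ℕ) :
    Fintype.card {i // d i ≤ m} = (Finset.univ.val.map d).countP (· ≤ m) := by
  rw [Multiset.countP_map, Fintype.card_subtype]
  rfl

theorem sum_dite_eq_sum_subtype {ι M : Type*} [Fintype ι] [AddCommMonoid M] (p : ι → Prop)
    [DecidablePred p] (f : {i // p i} → M) :
    ∑ i, (if h : p i then f ⟨i, h⟩ else 0) = ∑ i, f i := by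
  rw [← Finset.sum_filter_of_ne (p := p) fun i _ h => by
      by_contra hp
      exact h (dif_neg hp),
    Finset.sum_subtype (p := p) _ (by simp)]
  exact Finset.sum_congr rfl fun i _ => dif_pos i.2

theorem mem_logDer_of_mul_mem [FiniteDimensional K V] (b : Module.Basis (Fin l) K V)
    (A : CentralArrangement K V) {H : Submodule K V} (hH : IsCoatom H)
    {η : Derivation K (MvPolynomial (Fin l) K) (MvPolynomial (Fin l) K)}
    (h : formPoly b (definingForm H) • η ∈ logDer b (A.delete H)) :
    η ∈ logDer b (A.delete H) := by
  rw [mem_logDer_iff] at h ⊢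
  intro H' hH'
  have h1 := h H' hH'
  rw [Derivation.smul_apply, smul_eq_mul] at h1
  exact (isRelPrime_formPoly b ((A.delete H).isCoatom _ hH') hH hH'.2).dvd_of_dvd_mul_left h1

/-- If `exp(A'') ⊆ exp(A')` and `m` is the remaining exponent of `A'`, then some member of degree
`m` of a homogeneous basis of `D(A')` does not belong to `D(A)`. -/
theorem exists_not_mem_logDer [FiniteDimensional K V] (b : Module.Basis (Fin l) K V)
    (A : CentralArrangement K V) {H : Submodule K V} (hH : H ∈ A.hyperplanes)
    (c : Module.Basis (Fin n) K H) {m : ℕ} {e : Multiset ℕ}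
    (hrestrict : HasHomogeneousBasis c (A.restrict H) e)
    {θ : Fin l → Derivation K (MvPolynomial (Fin l) K) (MvPolynomial (Fin l) K)} {d : Fin l → ℕ}
    (hd : ∀ i j, (θ i (X j)).IsHomogeneous (d i)) (hmem : ∀ i, θ i ∈ logDer b (A.delete H))
    (hli : ∀ g : Fin l → MvPolynomial (Fin l) K, ∑ i, g i • θ i = 0 → g = 0)
    (hsp : ∀ η ∈ logDer b (A.delete H),
      ∃ g : Fin l → MvPolynomial (Fin l) K, η = ∑ i, g i • θ i)
    (he : m ::ₘ e = Finset.univ.val.map d) :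
    ∃ k, d k ≤ m ∧ pullbackHom b c H.subtype (θ k (formPoly b (definingForm H))) ≠ 0 := by
  by_contra! hcon
  have hHc := A.isCoatom H hH
  obtain ⟨π, hπ⟩ := exists_retraction H
  have hker : LinearMap.ker (definingForm H) = LinearMap.range H.subtype := by
    rw [ker_definingForm hHc, Submodule.range_subtype]
  set ρ := pullbackHom b c H.subtype with hρ
  set α := definingForm H with hα
  obtain ⟨η, d'', hd'', -, -, hsp'', he''⟩ := hrestrict
  have hbar : ∀ i : {i // d i ≤ m}, ∃ g : Fin n → MvPolynomial (Fin n) K,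
      (∀ j, d i < d'' j → g j = 0) ∧
        inducedDerivation b c H.subtype π (θ i) = ∑ j, g j • η j := by
    intro i
    refine exists_eq_sum_of_isHomogeneous (fun j => ?_) hd''
      (hsp'' _ (inducedDerivation_mem_logDer b A hHc c hπ (hcon i i.2) (hmem i)))
    rw [inducedDerivation, mkDerivation_X]
    exact isHomogeneous_pullbackHom _ _ _ (isHomogeneous_derivation_formPoly b (hd i) _)
  choose a ha0 ha using hbar
  obtain ⟨g, hg0, hg⟩ := exists_relation_of_card_lt
    (fun (i : {i // d i ≤ m}) (j : {j // d'' j ≤ m}) => a i j) (by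
      rw [card_le_eq_countP, card_le_eq_countP, ← he, ← he'', Multiset.countP_cons]
      simp)
  have hg' : ∀ j, ∑ i, g i * a i j = 0 := fun j => by
    by_cases hj : d'' j ≤ m
    · exact hg ⟨j, hj⟩
    · exact Finset.sum_eq_zero fun i _ => by
        rw [ha0 i j (by have := i.2; omega), mul_zero]
  set σ := pullbackHom c b π
  have hρσ : ∀ f, ρ (σ f) = f := pullbackHom_pullbackHom_of_comp_eq_id b c hπ
  set G : Fin l → MvPolynomial (Fin l) K := fun i => if h : d i ≤ m then σ (g ⟨i, h⟩) else 0 with hG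
  have hdvd : ∀ β, formPoly b α ∣ (∑ i, G i • θ i) (formPoly b β) := by
    intro β
    rw [← pullbackHom_eq_zero_iff b c hπ hker, derivation_sum_smul_apply, map_sum]
    have h1 : ∀ i, ρ (G i * θ i (formPoly b β)) = if h : d i ≤ m then
        g ⟨i, h⟩ * ∑ j, a ⟨i, h⟩ j * η j (formPoly c (β ∘ₗ H.subtype)) else 0 := by
      intro i
      simp only [hG]
      split_ifs with h
      · rw [map_mul, hρσ, ← derivation_sum_smul_apply, ← ha ⟨i, h⟩,
          inducedDerivation_formPoly b c hπ hker (hcon i h)]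
      · simp
    rw [Finset.sum_congr rfl fun i _ => h1 i, sum_dite_eq_sum_subtype (fun i => d i ≤ m)
      fun i => g i * ∑ j, a i j * η j (formPoly c (β ∘ₗ H.subtype))]
    have h2 : ∑ i : {i // d i ≤ m}, g i * ∑ j, a i j * η j (formPoly c (β ∘ₗ H.subtype)) = 0 := by
      rw [Finset.sum_congr rfl fun i _ => Finset.mul_sum _ _ _, Finset.sum_comm]
      refine Finset.sum_eq_zero fun j _ => ?_
      simp only [← mul_assoc]
      rw [← Finset.sum_mul, hg', zero_mul]
    exact h2
  obtain ⟨ζ, hζ⟩ := exists_eq_smul_of_forall_dvd b hdvd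
  have hζmem : ζ ∈ logDer b (A.delete H) := by
    refine mem_logDer_of_mul_mem b A hHc ?_
    rw [← hα, ← hζ]
    exact Submodule.sum_mem _ fun i _ => Submodule.smul_mem _ _ (hmem i)
  obtain ⟨h, hh⟩ := hsp ζ hζmem
  have hzero := hli (fun i => G i - formPoly b α * h i) (by
    ext1 f
    have h1 := DFunLike.congr_fun hζ (X f)
    have h2 := DFunLike.congr_fun hh (X f)
    rw [Derivation.smul_apply, h2] at h1
    simp only [derivation_sum_smul_apply, smul_eq_mul, Finset.mul_sum] at h1 ⊢
    simp only [sub_mul, mul_assoc, Finset.sum_sub_distrib, h1, sub_self, Derivation.coe_zero,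
      Pi.zero_apply])
  refine hg0 (funext fun i => ?_)
  have h1 := congrFun hzero i
  simp only [Pi.zero_apply, sub_eq_zero, hG, dif_pos i.2] at h1
  have h2 := congrArg ρ h1
  rw [hρσ, (pullbackHom_eq_zero_iff b c hπ hker _).2 (dvd_mul_right _ _)] at h2
  exact h2

/-- Terao's addition theorem. -/
theorem HasHomogeneousBasis.addition [FiniteDimensional K V] {b : Module.Basis (Fin l) K V}
    {A : CentralArrangement K V} {H : Submodule K V} (hH : H ∈ A.hyperplanes)
    {c : Module.Basis (Fin n) K H} {m : ℕ} {e : Multiset ℕ}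
    (hrestrict : HasHomogeneousBasis c (A.restrict H) e)
    (hdelete : HasHomogeneousBasis b (A.delete H) (m ::ₘ e))
    (hsum'' : e.sum = (A.restrict H).hyperplanes.ncard)
    (hsum' : (m ::ₘ e).sum = (A.delete H).hyperplanes.ncard) :
    HasHomogeneousBasis b A ((m + 1) ::ₘ e) := by
  classical
  have hHc := A.isCoatom H hH
  obtain ⟨π, hπ⟩ := exists_retraction H
  have hker : LinearMap.ker (definingForm H) = LinearMap.range H.subtype := by
    rw [ker_definingForm hHc, Submodule.range_subtype]
  obtain ⟨B, m', hB0, hB, hcard, hdvd⟩ := exists_dvd_apply_definingForm b A hH c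
  obtain rfl : m' = m := by
    rw [Multiset.sum_cons] at hsum'
    omega
  obtain ⟨θ, d, hd, hmem, hli, hsp, he⟩ := hdelete
  have hq := fun i => exists_isHomogeneous_quotient (isHomogeneous_pullbackHom b c H.subtype
    (isHomogeneous_derivation_formPoly b (hd i) (definingForm H))) hB (hdvd _ (hmem i))
  choose q hq hq0 hqd using hq
  obtain ⟨k, hkm, hk⟩ := exists_not_mem_logDer b A hH c hrestrict hd hmem hli hsp he
  have hqk : q k ≠ 0 := fun h => hk (by rw [hq, h, zero_mul])
  have hdk : d k = m' := by
    by_contra hne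
    exact hqk (hq0 k (by omega))
  set ρ := pullbackHom b c H.subtype with hρ
  set α := definingForm H with hα
  set σ := pullbackHom c b π
  have hρσ : ∀ f, ρ (σ f) = f := pullbackHom_pullbackHom_of_comp_eq_id b c hπ
  have hker0 : ∀ f, ρ f = 0 ↔ formPoly b α ∣ f := pullbackHom_eq_zero_iff b c hπ hker
  obtain ⟨t, ht⟩ : ∃ t : K, q k = C t := by
    have := hqd k hdk.ge
    rw [hdk, Nat.sub_self, ← totalDegree_zero_iff_isHomogeneous, totalDegree_eq_zero_iff_eq_C] at this
    exact ⟨_, this⟩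
  have ht0 : t ≠ 0 := by
    rintro rfl
    exact hqk (by rw [ht, C_0])
  set u : Fin l → MvPolynomial (Fin l) K := fun j => C t⁻¹ * σ (q j) with hu
  have huk : u k = 1 := by
    simp only [hu, ht]
    rw [← algebraMap_eq, ← algebraMap_eq, AlgHom.commutes, ← map_mul, inv_mul_cancel₀ ht0, map_one]
  have hρu : ∀ j, ρ (u j) = C t⁻¹ * q j := fun j => by
    simp only [hu, map_mul, hρσ]
    rw [← algebraMap_eq, AlgHom.commutes, algebraMap_eq]
  set w : Fin l → MvPolynomial (Fin l) K := fun j => if j = k then formPoly b α else -u j with hw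
  set θ' : Fin l → Derivation K (MvPolynomial (Fin l) K) (MvPolynomial (Fin l) K) :=
    fun j => (if j = k then 0 else θ j) + w j • θ k with hθ'
  have hθ'k : θ' k = formPoly b α • θ k := by simp [hθ', hw]
  have hθ'j : ∀ j, j ≠ k → θ' j = θ j - u j • θ k := fun j hj => by
    ext
    simp [hθ', hw, hj, sub_eq_add_neg]
  have hcomb : ∀ g : Fin l → MvPolynomial (Fin l) K,
      ∑ j, g j • θ' j = ∑ j, Function.update g k (∑ i, g i * w i) j • θ j := by
    intro g
    simp only [hθ', smul_add, Finset.sum_add_distrib, smul_smul, ← Finset.sum_smul]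
    rw [← Finset.add_sum_erase Finset.univ _ (Finset.mem_univ k),
      ← Finset.add_sum_erase Finset.univ (fun j => Function.update g k _ j • θ j)
        (Finset.mem_univ k)]
    rw [if_pos rfl, smul_zero, zero_add, Function.update_self, add_comm]
    refine congrArg₂ _ rfl (Finset.sum_congr rfl fun j hj => ?_)
    rw [if_neg (Finset.ne_of_mem_erase hj), Function.update_of_ne (Finset.ne_of_mem_erase hj)]
  refine ⟨θ', fun j => if j = k then m' + 1 else d j, fun j i => ?_, fun j => ?_, fun g hg => ?_,
    fun η hη => ?_, ?_⟩
  · beta_reduce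
    by_cases hj : j = k
    · subst hj
      rw [hθ'k, if_pos rfl, Derivation.smul_apply, smul_eq_mul, add_comm, ← hdk]
      exact (isHomogeneous_formPoly b α).mul (hd j i)
    · rw [hθ'j j hj, if_neg hj, Derivation.sub_apply, Derivation.smul_apply, smul_eq_mul]
      refine (hd j i).sub ?_
      by_cases hjm : m' ≤ d j
      · have := ((isHomogeneous_pullbackHom c b π (hqd j hjm)).C_mul t⁻¹).mul (hd k i)
        rwa [hdk, Nat.sub_add_cancel hjm] at this
      · simp only [hu, hq0 j (by omega), map_zero, mul_zero, zero_mul]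
        exact isHomogeneous_zero _ _ _
  · rw [mem_logDer_of_delete b A hH]
    by_cases hj : j = k
    · subst hj
      rw [hθ'k]
      exact ⟨Submodule.smul_mem _ _ (hmem _), dvd_mul_right _ _⟩
    · rw [hθ'j j hj]
      refine ⟨Submodule.sub_mem _ (hmem _) (Submodule.smul_mem _ _ (hmem _)), ?_⟩
      rw [← hker0, Derivation.sub_apply, Derivation.smul_apply, smul_eq_mul, map_sub, map_mul,
        hρu, hq, hq, ht]
      have : (C t⁻¹ : MvPolynomial (Fin n) K) * C t = 1 := by
        rw [← C_mul, inv_mul_cancel₀ ht0, C_1]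
      linear_combination -(q j * B) * this
  · rw [hcomb] at hg
    have h1 := hli _ hg
    have h2 : ∀ j, j ≠ k → g j = 0 := fun j hj => by
      have := congrFun h1 j
      rwa [Function.update_of_ne hj] at this
    have h3 := congrFun h1 k
    rw [Function.update_self, Finset.sum_eq_single k (fun j _ hj => by rw [h2 j hj, zero_mul])
      (by simp)] at h3
    simp only [hw, if_true, Pi.zero_apply, mul_eq_zero] at h3
    ext1 j
    by_cases hj : j = k
    · subst hj
      exact h3.resolve_right ((formPoly_eq_zero_iff b).not.2 (definingForm_ne_zero hHc))
    · exact h2 j hj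
  · rw [mem_logDer_of_delete b A hH] at hη
    obtain ⟨G, hG⟩ := hsp η hη.1
    have h1 : formPoly b α ∣ ∑ j, G j * u j := by
      have h2 := (hker0 _).2 hη.2
      rw [← hα, hG, derivation_sum_smul_apply, map_sum] at h2
      rw [← hker0, map_sum]
      have h3 : (∑ j, ρ (G j * u j)) * B = C t⁻¹ * ∑ j, ρ (G j * θ j (formPoly b α)) := by
        rw [Finset.sum_mul, Finset.mul_sum]
        refine Finset.sum_congr rfl fun j _ => ?_
        rw [map_mul ρ (G j) (u j), map_mul ρ (G j) (θ j _), hρu, hq]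
        ring
      rw [h2, mul_zero, mul_eq_zero] at h3
      exact h3.resolve_right hB0
    obtain ⟨h, hh⟩ := h1
    refine ⟨Function.update G k h, ?_⟩
    rw [hcomb, hG]
    refine Finset.sum_congr rfl fun j _ => ?_
    by_cases hj : j = k
    · subst hj
      rw [Function.update_self, ← Finset.add_sum_erase _ _ (Finset.mem_univ j),
        Function.update_self]
      rw [← Finset.add_sum_erase _ _ (Finset.mem_univ j), huk, mul_one] at hh
      have h4 : ∑ x ∈ Finset.univ.erase j, Function.update G j h x * w x =
          -∑ x ∈ Finset.univ.erase j, G x * u x := by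
        rw [← Finset.sum_neg_distrib]
        refine Finset.sum_congr rfl fun x hx => ?_
        rw [Function.update_of_ne (Finset.ne_of_mem_erase hx)]
        simp only [hw, if_neg (Finset.ne_of_mem_erase hx), mul_neg]
      rw [h4]
      congr 1
      simp only [hw, if_true]
      linear_combination hh
    · rw [Function.update_of_ne hj, Function.update_of_ne hj]
  · have h1 : (Finset.univ : Finset (Fin l)).val = k ::ₘ (Finset.univ.erase k).val := by
      rw [← Finset.insert_val_of_notMem (Finset.notMem_erase k _),
        Finset.insert_erase (Finset.mem_univ k)]
    rw [h1, Multiset.map_cons, hdk, Multiset.cons_inj_right] at he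
    rw [h1, Multiset.map_cons, if_pos rfl, he]
    refine congrArg _ (Multiset.map_congr rfl fun j hj => ?_)
    rw [if_neg (Finset.ne_of_mem_erase (Finset.mem_def.2 hj))]

end Addition

end CentralArrangement

namespace CentralArrangement

section Pullback

variable {K : Type*} [Field K] {V W U : Type*} [AddCommGroup V] [Module K V] [AddCommGroup W]
  [Module K W] [AddCommGroup U] [Module K U]

theorem isCoatom_comap {H : Submodule K V} (hH : IsCoatom H) {g : W →ₗ[K] V}
    (hg : ¬ LinearMap.range g ≤ H) : IsCoatom (H.comap g) := by
  have h : H.comap g = LinearMap.ker (definingForm H ∘ₗ g) := by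
    rw [LinearMap.ker_comp, ker_definingForm hH]
  rw [h]
  refine isCoatom_ker_of_ne_zero fun h0 => hg ?_
  rw [← ker_definingForm hH]
  exact LinearMap.range_le_ker_iff.2 h0

/-- The arrangement of the hyperplanes `g⁻¹(H)`, where `H` runs through the hyperplanes of `A`
which do not contain the image of `g`. -/
def pullback (A : CentralArrangement K V) (g : W →ₗ[K] V) : CentralArrangement K W where
  hyperplanes := {Y | ∃ H ∈ A.hyperplanes, ¬ LinearMap.range g ≤ H ∧ Y = H.comap g}
  finite := (A.finite.image fun H => H.comap g).subset (by
    rintro Y ⟨H, hH, -, rfl⟩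
    exact ⟨H, hH, rfl⟩)
  isCoatom := by
    rintro Y ⟨H, hH, hX, rfl⟩
    exact isCoatom_comap (A.isCoatom H hH) hX

theorem restrict_eq_pullback (A : CentralArrangement K V) (X : Submodule K V) :
    A.restrict X = A.pullback X.subtype := by
  ext Y
  simp [restrict, pullback]

theorem pullback_pullback (A : CentralArrangement K V) (g : W →ₗ[K] V) (h : U →ₗ[K] W) :
    (A.pullback g).pullback h = A.pullback (g ∘ₗ h) := by
  ext Y
  constructor
  · rintro ⟨_, ⟨H, hH, h1, rfl⟩, h2, rfl⟩
    refine ⟨H, hH, ?_, Submodule.comap_comp _ _ _⟩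
    rwa [LinearMap.range_comp, Submodule.map_le_iff_le_comap]
  · rintro ⟨H, hH, h1, rfl⟩
    refine ⟨H.comap g, ⟨H, hH, fun h2 => h1 ?_, rfl⟩, ?_, Submodule.comap_comp _ _ _⟩
    · exact (LinearMap.range_comp_le_range h g).trans h2
    · rwa [LinearMap.range_comp, Submodule.map_le_iff_le_comap] at h1

theorem pullback_surjective {A : CentralArrangement K V} {g : W →ₗ[K] V}
    (hg : Function.Surjective g) :
    (A.pullback g).hyperplanes = Submodule.comap g '' A.hyperplanes := by
  ext Y
  constructor
  · rintro ⟨H, hH, h1, rfl⟩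
    exact ⟨H, hH, rfl⟩
  · rintro ⟨H, hH, rfl⟩
    exact ⟨H, hH, by rw [LinearMap.range_eq_top.2 hg, top_le_iff]; exact (A.isCoatom H hH).1, rfl⟩

theorem pullback_id (A : CentralArrangement K V) : A.pullback LinearMap.id = A := by
  ext Y
  rw [pullback_surjective Function.surjective_id]
  simp

theorem pullback_delete_comap {A : CentralArrangement K V} {g : W →ₗ[K] V}
    (hg : Function.Surjective g) (H : Submodule K V) :
    (A.pullback g).delete (H.comap g) = (A.delete H).pullback g := by
  have hinj := Submodule.comap_injective_of_surjective hg
  ext1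
  rw [pullback_surjective hg]
  change (A.pullback g).hyperplanes \ {H.comap g} = _
  rw [pullback_surjective hg, ← Set.image_singleton, ← Set.image_sdiff hinj]
  rfl

theorem finrank_add_one_of_isCoatom [FiniteDimensional K V] {H : Submodule K V}
    (hH : IsCoatom H) : Module.finrank K H + 1 = Module.finrank K V := by
  have := Module.Dual.finrank_ker_add_one_of_ne_zero (definingForm_ne_zero hH)
  rwa [ker_definingForm hH] at this

end Pullback

/-- The inductively free arrangements together with the exponents furnished by the addition
theorem. -/
inductive IsInductivelyFreeWith {K : Type*} [Field K] :
    ∀ {V : Type u} [AddCommGroup V] [Module K V], CentralArrangement K V → Multiset ℕ → Prop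
  | empty (V : Type u) [AddCommGroup V] [Module K V] [FiniteDimensional K V] :
      IsInductivelyFreeWith (CentralArrangement.empty K V)
        (Multiset.replicate (Module.finrank K V) 0)
  | add {V : Type u} [AddCommGroup V] [Module K V] (A : CentralArrangement K V)
      (H : Submodule K V) (hH : H ∈ A.hyperplanes) (m : ℕ) (e : Multiset ℕ)
      (hrestrict : IsInductivelyFreeWith (A.restrict H) e)
      (hdelete : IsInductivelyFreeWith (A.delete H) (m ::ₘ e)) :
      IsInductivelyFreeWith A ((m + 1) ::ₘ e)

namespace IsInductivelyFreeWith

variable {K : Type*} [Field K] {V W : Type u} [AddCommGroup V] [Module K V] [AddCommGroup W]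
  [Module K W] {A : CentralArrangement K V} {e : Multiset ℕ}

theorem finiteDimensional (h : A.IsInductivelyFreeWith e) : FiniteDimensional K V := by
  induction h with
  | empty V => assumption
  | add A H hH m e _ _ _ ih => exact ih

theorem card_eq_finrank (h : A.IsInductivelyFreeWith e) : e.card = Module.finrank K V := by
  induction h with
  | empty V => simp
  | add A H hH m e _ _ _ ih => simpa using ih

theorem sum_eq_ncard (h : A.IsInductivelyFreeWith e) : e.sum = A.hyperplanes.ncard := by
  induction h with
  | empty V => simp [CentralArrangement.empty]
  | add A H hH m e _ _ _ ih =>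
    rw [← Set.ncard_sdiff_singleton_add_one hH A.finite]
    change _ = (A.delete H).hyperplanes.ncard + 1
    rw [← ih, Multiset.sum_cons, Multiset.sum_cons]
    omega

theorem hasHomogeneousBasis (h : A.IsInductivelyFreeWith e) {l : ℕ}
    (b : Module.Basis (Fin l) K V) : HasHomogeneousBasis b A e := by
  induction h generalizing l with
  | empty V => exact hasHomogeneousBasis_empty b
  | add A H hH m e hr hd ihr ihd =>
    have := hd.finiteDimensional
    exact HasHomogeneousBasis.addition hH (ihr (Module.finBasis K H)) (ihd b) hr.sum_eq_ncard
      hd.sum_eq_ncard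

theorem isFreeWithExponents (h : A.IsInductivelyFreeWith e) : A.IsFreeWithExponents e :=
  have := h.finiteDimensional
  (h.hasHomogeneousBasis (Module.finBasis K V)).isFreeWithExponents

theorem isInductivelyFree (h : A.IsInductivelyFreeWith e) : A.IsInductivelyFree := by
  induction h with
  | empty V => exact IsInductivelyFree.empty V
  | add A H hH m e hr hd ihr ihd =>
    exact IsInductivelyFree.add A H hH _ _ ihr ihd hr.isFreeWithExponents hd.isFreeWithExponents
      (Multiset.le_cons_self e m)

theorem pullback_of_surjective (h : A.IsInductivelyFreeWith e) [FiniteDimensional K W]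
    {f : W →ₗ[K] V} (hf : Function.Surjective f) {k : ℕ}
    (hk : Module.finrank K W = Module.finrank K V + k) :
    (A.pullback f).IsInductivelyFreeWith (e + Multiset.replicate k 0) := by
  induction h generalizing W with
  | empty V =>
    have h0 : (CentralArrangement.empty K V).pullback f = CentralArrangement.empty K W := by
      ext
      simp [pullback, CentralArrangement.empty]
    rw [h0, ← Multiset.replicate_add, ← hk]
    exact .empty W
  | @add V _ _ A H hH m e hr hd ihr ihd =>
    have := hd.finiteDimensional
    rw [Multiset.cons_add]
    have hle : ¬ LinearMap.range f ≤ H := by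
      rw [LinearMap.range_eq_top.2 hf, top_le_iff]
      exact (A.isCoatom H hH).1
    have hmem : H.comap f ∈ (A.pullback f).hyperplanes := ⟨H, hH, hle, rfl⟩
    refine .add _ (H.comap f) hmem m _ ?_ ?_
    · set f' : H.comap f →ₗ[K] H := f.restrict fun x hx => hx with hf'
      have hcomp : f ∘ₗ (H.comap f).subtype = H.subtype ∘ₗ f' := by
        ext x
        rfl
      rw [restrict_eq_pullback, pullback_pullback, hcomp, ← pullback_pullback,
        ← restrict_eq_pullback]
      refine ihr (fun y => ?_) ?_
      · obtain ⟨x, hx⟩ := hf y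
        exact ⟨⟨x, by rw [Submodule.mem_comap, hx]; exact y.2⟩, Subtype.ext hx⟩
      · have h1 := finrank_add_one_of_isCoatom (A.isCoatom H hH)
        have h2 := finrank_add_one_of_isCoatom (isCoatom_comap (A.isCoatom H hH) hle)
        omega
    · rw [pullback_delete_comap hf, ← Multiset.cons_add]
      exact ihd hf hk

theorem pullback_equiv (h : A.IsInductivelyFreeWith e) (f : W ≃ₗ[K] V) :
    (A.pullback f.toLinearMap).IsInductivelyFreeWith e := by
  have := h.finiteDimensional
  have := f.symm.finiteDimensional
  simpa using h.pullback_of_surjective (f := f.toLinearMap) f.surjective (k := 0) f.finrank_eq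

theorem restrict_of_pullback {g : W →ₗ[K] V} (hg : Function.Injective g) {X : Submodule K V}
    (hX : LinearMap.range g = X) (h : (A.pullback g).IsInductivelyFreeWith e) :
    (A.restrict X).IsInductivelyFreeWith e := by
  subst hX
  have := h.pullback_equiv (LinearEquiv.ofInjective g hg).symm
  rw [pullback_pullback] at this
  rw [restrict_eq_pullback]
  convert this
  ext x
  simp

/-- The addition step, with the restriction to the hyperplane parametrized by an injective map. -/
theorem add_of_pullback {g : W →ₗ[K] V} (hg : Function.Injective g)
    (hH : LinearMap.range g ∈ A.hyperplanes) {m : ℕ}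
    (hrestrict : (A.pullback g).IsInductivelyFreeWith e)
    (hdelete : (A.delete (LinearMap.range g)).IsInductivelyFreeWith (m ::ₘ e)) :
    A.IsInductivelyFreeWith ((m + 1) ::ₘ e) :=
  .add A _ hH m e (hrestrict.restrict_of_pullback hg rfl) hdelete

end IsInductivelyFreeWith

/-- `A` has a flag of flats whose restrictions are inductively free, the exponents of the
`d`-dimensional one being the first `d` members of the list. -/
inductive HasInductiveFlag {K : Type*} [Field K] :
    ∀ {V : Type u} [AddCommGroup V] [Module K V], CentralArrangement K V → List ℕ → Prop
  | base {V : Type u} [AddCommGroup V] [Module K V] (A : CentralArrangement K V) (x : ℕ)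
      (h : A.IsInductivelyFreeWith ([x] : List ℕ)) : HasInductiveFlag A [x]
  | step {V W : Type u} [AddCommGroup V] [Module K V] [AddCommGroup W] [Module K W]
      (A : CentralArrangement K V) (g : W →ₗ[K] V) (hg : Function.Injective g)
      (hH : LinearMap.range g ∈ A.hyperplanes) (L : List ℕ) (x : ℕ)
      (hflag : HasInductiveFlag (A.pullback g) L)
      (h : A.IsInductivelyFreeWith (L ++ [x] : List ℕ)) : HasInductiveFlag A (L ++ [x])

namespace HasInductiveFlag

variable {K : Type*} [Field K] {V W : Type u} [AddCommGroup V] [Module K V] [AddCommGroup W]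
  [Module K W] {A : CentralArrangement K V} {L : List ℕ}

theorem isInductivelyFreeWith (h : A.HasInductiveFlag L) : A.IsInductivelyFreeWith L := by
  cases h <;> assumption

theorem length_eq_finrank (h : A.HasInductiveFlag L) : L.length = Module.finrank K V := by
  simpa using h.isInductivelyFreeWith.card_eq_finrank

theorem pullback_equiv (h : A.HasInductiveFlag L) (f : W ≃ₗ[K] V) :
    (A.pullback f.toLinearMap).HasInductiveFlag L := by
  cases h with
  | base A x h => exact .base _ _ (h.pullback_equiv f)
  | step A g hg hH L x hflag h =>
    have hcomp : f.toLinearMap ∘ₗ (f.symm.toLinearMap ∘ₗ g) = g := by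
      ext
      simp
    have hrange : LinearMap.range (f.symm.toLinearMap ∘ₗ g) =
        (LinearMap.range g).comap f.toLinearMap := by
      rw [LinearMap.range_comp]
      exact (Submodule.comap_equiv_eq_map_symm f _).symm
    refine .step _ (f.symm.toLinearMap ∘ₗ g) (f.symm.injective.comp hg) ?_ L x ?_
      (h.pullback_equiv f)
    · rw [hrange, pullback_surjective f.surjective]
      exact ⟨_, hH, rfl⟩
    · rwa [pullback_pullback, hcomp]

theorem map_mem_flats {g : W →ₗ[K] V} (hH : LinearMap.range g ∈ A.hyperplanes)
    {Y : Submodule K W} (hY : Y ∈ (A.pullback g).flats) : Y.map g ∈ A.flats := by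
  obtain ⟨B, hB, rfl⟩ := hY
  refine ⟨insert (LinearMap.range g) {X | X ∈ A.hyperplanes ∧ X.comap g ∈ B}, ?_, ?_⟩
  · rintro X (rfl | hX)
    · exact hH
    · exact hX.1
  · refine le_antisymm ?_ ?_
    · rintro _ ⟨w, hw, rfl⟩
      rw [Submodule.mem_sInf]
      rintro X (rfl | hX)
      · exact ⟨w, rfl⟩
      · exact (Submodule.mem_sInf.1 hw) _ hX.2
    · intro v hv
      rw [Submodule.mem_sInf] at hv
      obtain ⟨w, rfl⟩ := hv _ (Set.mem_insert _ _)
      refine ⟨w, Submodule.mem_sInf.2 fun Z hZ => ?_, rfl⟩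
      obtain ⟨X, hX, -, rfl⟩ := hB hZ
      exact hv X (Set.mem_insert_of_mem _ ⟨hX, hZ⟩)

theorem exists_flag (h : A.HasInductiveFlag L) :
    ∃ X : ℕ → Submodule K V, (∀ d, 1 ≤ d → d ≤ Module.finrank K V →
      X d ∈ A.flats ∧ Module.finrank K (X d) = d ∧
        (A.restrict (X d)).IsInductivelyFreeWith (L.take d : List ℕ)) ∧
    ∀ d, 1 ≤ d → d + 1 ≤ Module.finrank K V → X d ≤ X (d + 1) := by
  have htop : ∀ {V : Type u} [AddCommGroup V] [Module K V] {A : CentralArrangement K V}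
      {L : List ℕ}, A.IsInductivelyFreeWith L → (⊤ : Submodule K V) ∈ A.flats ∧
        Module.finrank K (⊤ : Submodule K V) = Module.finrank K V ∧
        (A.restrict ⊤).IsInductivelyFreeWith (L.take (Module.finrank K V) : List ℕ) := by
    intro V _ _ A L h
    refine ⟨⟨∅, Set.empty_subset _, by simp⟩, finrank_top K V, ?_⟩
    rw [List.take_of_length_le (by rw [← h.card_eq_finrank, Multiset.coe_card])]
    refine IsInductivelyFreeWith.restrict_of_pullback (g := LinearMap.id)
      Function.injective_id LinearMap.range_id ?_
    rwa [pullback_id]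
  induction h with
  | base A x h =>
    have h1 := h.card_eq_finrank
    rw [Multiset.coe_card, List.length_singleton] at h1
    refine ⟨fun _ => ⊤, fun d hd hd' => ?_, fun _ _ _ => le_rfl⟩
    obtain rfl := le_antisymm hd' (h1 ▸ hd)
    exact htop h
  | @step V W _ _ _ _ A g hg hH L x hflag h ih =>
    obtain ⟨X, hX, hle⟩ := ih
    have hW := hflag.length_eq_finrank
    have hV := h.card_eq_finrank
    rw [Multiset.coe_card, List.length_append, List.length_singleton, hW] at hV
    refine ⟨fun d => if d ≤ Module.finrank K W then (X d).map g else ⊤, fun d hd hd' => ?_,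
      fun d hd hd' => ?_⟩
    · by_cases hdW : d ≤ Module.finrank K W
      · have hXd : (if d ≤ Module.finrank K W then (X d).map g else ⊤) = (X d).map g := if_pos hdW
        beta_reduce
        rw [hXd]
        obtain ⟨h1, h2, h3⟩ := hX d hd hdW
        refine ⟨map_mem_flats hH h1, ?_, ?_⟩
        · rw [← (Submodule.equivMapOfInjective g hg (X d)).finrank_eq, h2]
        · rw [List.take_append_of_le_length (by omega)]
          refine IsInductivelyFreeWith.restrict_of_pullback (g := g ∘ₗ (X d).subtype)
            (hg.comp (Submodule.subtype_injective _)) ?_ ?_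
          · rw [LinearMap.range_comp, Submodule.range_subtype]
          · rwa [← pullback_pullback, ← restrict_eq_pullback]
      · have hXd : (if d ≤ Module.finrank K W then (X d).map g else ⊤) = ⊤ := if_neg hdW
        beta_reduce
        rw [hXd]
        obtain rfl : d = Module.finrank K V := by omega
        exact htop h
    · by_cases hdW : d + 1 ≤ Module.finrank K W
      · simp only [if_pos hdW, if_pos (show d ≤ Module.finrank K W by omega)]
        exact Submodule.map_mono (hle d hd hdW)
      · simp only [if_neg hdW, le_top]

theorem isIndFlagAccurate (h : A.HasInductiveFlag L) (hL : L.Pairwise (· ≤ ·)) :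
    A.IsIndFlagAccurate := by
  obtain ⟨X, hX, hle⟩ := h.exists_flag
  have hw : A.IsFlagAccuracyWitness X :=
    ⟨L, hL, h.isInductivelyFreeWith.isFreeWithExponents,
      fun d hd hd' => ⟨(hX d hd hd').1, (hX d hd hd').2.1, (hX d hd hd').2.2.isFreeWithExponents⟩,
      hle⟩
  exact ⟨h.isInductivelyFreeWith.isInductivelyFree, ⟨X, hw⟩, X, hw,
    fun d hd hd' => (hX d hd hd').2.2.isInductivelyFree⟩

end HasInductiveFlag

end CentralArrangement

open CentralArrangement

section Hyperplanes

variable {l : ℕ}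

theorem mem_homogenizedHyperplane {K V : Type*} [Field K] [AddCommGroup V] [Module K V]
    {φ : Module.Dual K V} {c : K} {v : V × K} :
    v ∈ homogenizedHyperplane φ c ↔ φ v.1 = c * v.2 := by
  simp [homogenizedHyperplane, sub_eq_zero]

theorem homogenizedHyperplane_congr {K V : Type*} [Field K] [AddCommGroup V] [Module K V]
    {φ ψ : Module.Dual K V} {c d : K} (hφ : φ ≠ 0) (hψ : ψ ≠ 0)
    (h : affineHyperplane φ c = affineHyperplane ψ d) :
    homogenizedHyperplane φ c = homogenizedHyperplane ψ d := by
  obtain ⟨t, rfl, rfl⟩ := affineHyperplane_eq_cases hφ h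
  have ht : t ≠ 0 := by
    rintro rfl
    exact hψ (zero_smul _ _)
  ext v
  simp [mem_homogenizedHyperplane, mul_assoc, ht]

/-- The hyperplane at infinity `z = 0`. -/
noncomputable def infHyperplane (l : ℕ) : Submodule ℝ ((Fin l → ℝ) × ℝ) :=
  LinearMap.ker (LinearMap.snd ℝ (Fin l → ℝ) ℝ)

/-- The hyperplane `x_i - x_j = c z`. -/
noncomputable def diffHyperplane (i j : Fin l) (c : ℤ) : Submodule ℝ ((Fin l → ℝ) × ℝ) :=
  homogenizedHyperplane (coordForm i - coordForm j) (c : ℝ)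

/-- The hyperplane `x_i = c z`. -/
noncomputable def coordHyperplane (i : Fin l) (c : ℤ) : Submodule ℝ ((Fin l → ℝ) × ℝ) :=
  homogenizedHyperplane (coordForm i) (c : ℝ)

theorem mem_infHyperplane {v : (Fin l → ℝ) × ℝ} : v ∈ infHyperplane l ↔ v.2 = 0 := by
  simp [infHyperplane]

theorem mem_diffHyperplane {i j : Fin l} {c : ℤ} {v : (Fin l → ℝ) × ℝ} :
    v ∈ diffHyperplane i j c ↔ v.1 i - v.1 j = c * v.2 := by
  simp [diffHyperplane, mem_homogenizedHyperplane, coordForm]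

theorem mem_coordHyperplane {i : Fin l} {c : ℤ} {v : (Fin l → ℝ) × ℝ} :
    v ∈ coordHyperplane i c ↔ v.1 i = c * v.2 := by
  simp [coordHyperplane, mem_homogenizedHyperplane, coordForm]

theorem infHyperplane_ne_coordHyperplane {i : Fin l} {c : ℤ} :
    infHyperplane l ≠ coordHyperplane i c := fun h => by
  have : (Pi.single i 1, 0) ∈ coordHyperplane i c := h ▸ mem_infHyperplane.2 rfl
  simp [mem_coordHyperplane] at this

theorem diffHyperplane_ne_coordHyperplane {i j p : Fin l} {c k : ℤ} :
    diffHyperplane i j c ≠ coordHyperplane p k := fun h => by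
  have : (fun _ => 1, 0) ∈ coordHyperplane p k := h ▸ mem_diffHyperplane.2 (by simp)
  simp [mem_coordHyperplane] at this

theorem coordHyperplane_inj {i p : Fin l} {c k : ℤ} (h : coordHyperplane i c = coordHyperplane p k) :
    i = p ∧ c = k := by
  obtain rfl : i = p := by
    by_contra hne
    have : (Pi.single p 1, 0) ∈ coordHyperplane p k :=
      h ▸ mem_coordHyperplane.2 (by simp [hne])
    simp [mem_coordHyperplane] at this
  have : (fun _ => (c : ℝ), 1) ∈ coordHyperplane i k := h ▸ mem_coordHyperplane.2 (by simp)
  simpa [mem_coordHyperplane] using this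

end Hyperplanes

section ShiCone

variable {l : ℕ}

/-- The cone over the arrangement `x_i - x_j = [1 - a, a]` for `i < j`, `x_i = N i`. -/
noncomputable def shiCone (a : ℕ) (N : Fin l → Finset ℤ) :
    CentralArrangement ℝ ((Fin l → ℝ) × ℝ) :=
  (deformation (fun i j => if i < j then Finset.Icc (1 - (a : ℤ)) a else ∅) N).cone

theorem mem_shiCone {a : ℕ} {N : Fin l → Finset ℤ} {Y : Submodule ℝ ((Fin l → ℝ) × ℝ)} :
    Y ∈ (shiCone a N).hyperplanes ↔ Y = infHyperplane l ∨
      (∃ i j, i < j ∧ ∃ c ∈ Finset.Icc (1 - (a : ℤ)) a, Y = diffHyperplane i j c) ∨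
      ∃ i, ∃ c ∈ N i, Y = coordHyperplane i c := by
  constructor
  · rintro (rfl | ⟨φ, c, hφ, h, rfl⟩)
    · exact Or.inl rfl
    · rcases h with ⟨i, j, hij, c', hc', h⟩ | ⟨i, c', hc', h⟩
      · by_cases hlt : i < j
        · simp only [if_pos hlt] at hc'
          exact Or.inr (Or.inl ⟨i, j, hlt, c', hc',
            homogenizedHyperplane_congr hφ (coordForm_sub_ne_zero hij) h⟩)
        · simp [hlt] at hc'
      · exact Or.inr (Or.inr ⟨i, c', hc',
          homogenizedHyperplane_congr hφ (coordForm_ne_zero i) h⟩)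
  · rintro (rfl | ⟨i, j, hij, c, hc, rfl⟩ | ⟨i, c, hc, rfl⟩)
    · exact Or.inl rfl
    · refine Or.inr ⟨_, _, coordForm_sub_ne_zero hij.ne, Or.inl ⟨i, j, hij.ne, c, ?_, rfl⟩, rfl⟩
      simpa only [if_pos hij] using hc
    · exact Or.inr ⟨_, _, coordForm_ne_zero i, Or.inr ⟨i, c, hc, rfl⟩, rfl⟩

theorem shiCone_delete {a : ℕ} {N : Fin l → Finset ℤ} {p : Fin l} {k : ℤ} (hk : k ∉ N p) :
    (shiCone a (Function.update N p (insert k (N p)))).delete (coordHyperplane p k) =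
      shiCone a N := by
  ext Y
  change Y ∈ (shiCone a _).hyperplanes ∧ Y ≠ coordHyperplane p k ↔ _
  rw [mem_shiCone, mem_shiCone]
  constructor
  · rintro ⟨rfl | h | ⟨i, c, hc, rfl⟩, hne⟩
    · exact Or.inl rfl
    · exact Or.inr (Or.inl h)
    · refine Or.inr (Or.inr ⟨i, c, ?_, rfl⟩)
      by_cases hi : i = p
      · subst hi
        rw [Function.update_self, Finset.mem_insert] at hc
        exact hc.resolve_left (by rintro rfl; exact hne rfl)
      · rwa [Function.update_of_ne hi] at hc
  · rintro (rfl | ⟨i, j, hij, c, hc, rfl⟩ | ⟨i, c, hc, rfl⟩)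
    · exact ⟨Or.inl rfl, infHyperplane_ne_coordHyperplane⟩
    · exact ⟨Or.inr (Or.inl ⟨i, j, hij, c, hc, rfl⟩), diffHyperplane_ne_coordHyperplane⟩
    · refine ⟨Or.inr (Or.inr ⟨i, c, ?_, rfl⟩), fun h => ?_⟩
      · by_cases hi : i = p
        · subst hi
          rw [Function.update_self]
          exact Finset.mem_insert_of_mem hc
        · rwa [Function.update_of_ne hi]
      · obtain ⟨rfl, rfl⟩ := coordHyperplane_inj h
        exact hk hc

/-- The parametrization `(y, z) ↦ (x, z)` of the hyperplane `x_p = k z`. -/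
noncomputable def insertCoord (p : Fin (l + 1)) (k : ℤ) :
    ((Fin l → ℝ) × ℝ) →ₗ[ℝ] ((Fin (l + 1) → ℝ) × ℝ) :=
  (LinearMap.pi (p.insertNth ((k : ℝ) • LinearMap.snd ℝ (Fin l → ℝ) ℝ)
    fun i => LinearMap.proj i ∘ₗ LinearMap.fst ℝ (Fin l → ℝ) ℝ)).prod (LinearMap.snd ℝ _ _)

theorem insertCoord_self (p : Fin (l + 1)) (k : ℤ) (v : (Fin l → ℝ) × ℝ) :
    (insertCoord p k v).1 p = k * v.2 := by
  simp [insertCoord]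

theorem insertCoord_succAbove (p : Fin (l + 1)) (k : ℤ) (v : (Fin l → ℝ) × ℝ) (i : Fin l) :
    (insertCoord p k v).1 (p.succAbove i) = v.1 i := by
  simp [insertCoord]

theorem insertCoord_snd (p : Fin (l + 1)) (k : ℤ) (v : (Fin l → ℝ) × ℝ) :
    (insertCoord p k v).2 = v.2 := by
  simp [insertCoord]

theorem insertCoord_injective (p : Fin (l + 1)) (k : ℤ) :
    Function.Injective (insertCoord (l := l) p k) := by
  intro v w h
  refine Prod.ext (funext fun i => ?_) ?_
  · rw [← insertCoord_succAbove p k v, h, insertCoord_succAbove]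
  · rw [← insertCoord_snd p k v, h, insertCoord_snd]

theorem range_insertCoord (p : Fin (l + 1)) (k : ℤ) :
    LinearMap.range (insertCoord (l := l) p k) = coordHyperplane p k := by
  ext v
  rw [mem_coordHyperplane]
  constructor
  · rintro ⟨w, rfl⟩
    rw [insertCoord_self, insertCoord_snd]
  · intro h
    refine ⟨(fun i => v.1 (p.succAbove i), v.2), Prod.ext (funext fun i => ?_) ?_⟩
    · rcases Fin.eq_self_or_eq_succAbove p i with rfl | ⟨j, rfl⟩
      · rw [insertCoord_self, h]
      · rw [insertCoord_succAbove]
    · rw [insertCoord_snd]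

theorem CentralArrangement.mem_pullback_of_comap_eq {K V W : Type*} [Field K] [AddCommGroup V]
    [Module K V] [AddCommGroup W] [Module K W] {A : CentralArrangement K V} {g : W →ₗ[K] V}
    {X : Submodule K V} {Y : Submodule K W} (hX : X ∈ A.hyperplanes) (h : X.comap g = Y)
    (hY : IsCoatom Y) : Y ∈ (A.pullback g).hyperplanes := by
  refine ⟨X, hX, fun hle => hY.1 ?_, h.symm⟩
  rw [← h, eq_top_iff]
  exact fun w _ => hle ⟨w, rfl⟩

/-- The values `c` such that `x_i = c z` is the trace on `x_p = k z` of one of the hyperplanes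
`x_i - x_p = [1 - a, a] z` (if `i < p`) or `x_p - x_i = [1 - a, a] z` (if `p < i`). -/
noncomputable def shiTrace (a : ℕ) (p : Fin (l + 1)) (k : ℤ) (i : Fin l) : Finset ℤ :=
  if i.val < p.val then Finset.Icc (k + 1 - a) (k + a) else Finset.Icc (k - a) (k + a - 1)

theorem shiCone_pullback_insertCoord (a : ℕ) (N : Fin (l + 1) → Finset ℤ) (p : Fin (l + 1))
    (k : ℤ) : (shiCone a N).pullback (insertCoord p k) =
      shiCone a fun i => N (p.succAbove i) ∪ shiTrace a p k i := by
  have cinf : (infHyperplane (l + 1)).comap (insertCoord p k) = infHyperplane l := by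
    ext v
    simp [mem_infHyperplane, insertCoord_snd]
  have cdiff : ∀ (i j : Fin l) (c : ℤ), (diffHyperplane (p.succAbove i) (p.succAbove j) c).comap
      (insertCoord p k) = diffHyperplane i j c := fun i j c => by
    ext v
    simp [mem_diffHyperplane, insertCoord_snd, insertCoord_succAbove]
  have cleft : ∀ (i : Fin l) (c : ℤ), (diffHyperplane (p.succAbove i) p c).comap
      (insertCoord p k) = coordHyperplane i (k + c) := fun i c => by
    ext v
    simp only [mem_diffHyperplane, mem_coordHyperplane, insertCoord_snd, insertCoord_succAbove,
      insertCoord_self, Submodule.mem_comap]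
    push_cast
    constructor <;> intro h <;> linarith
  have cright : ∀ (i : Fin l) (c : ℤ), (diffHyperplane p (p.succAbove i) c).comap
      (insertCoord p k) = coordHyperplane i (k - c) := fun i c => by
    ext v
    simp only [mem_diffHyperplane, mem_coordHyperplane, insertCoord_snd, insertCoord_succAbove,
      insertCoord_self, Submodule.mem_comap]
    push_cast
    constructor <;> intro h <;> linarith
  have ccoord : ∀ (i : Fin l) (c : ℤ), (coordHyperplane (p.succAbove i) c).comap
      (insertCoord p k) = coordHyperplane i c := fun i c => by
    ext v
    simp [mem_coordHyperplane, insertCoord_snd, insertCoord_succAbove]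
  have hlt : ∀ i : Fin l, p.succAbove i < p ↔ i.val < p.val := fun i => by
    rw [Fin.succAbove_lt_iff_castSucc_lt, Fin.lt_def, Fin.val_castSucc]
  have hgt : ∀ i : Fin l, p < p.succAbove i ↔ ¬ i.val < p.val := fun i => by
    rw [Fin.lt_succAbove_iff_le_castSucc, Fin.le_def, Fin.val_castSucc, not_lt]
  ext Y
  constructor
  · rintro ⟨X, hX, hle, rfl⟩
    rw [mem_shiCone] at hX ⊢
    rcases hX with rfl | ⟨i, j, hij, c, hc, rfl⟩ | ⟨i, c, hc, rfl⟩
    · exact Or.inl cinf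
    · rw [Finset.mem_Icc] at hc
      rcases Fin.eq_self_or_eq_succAbove p i with rfl | ⟨i, rfl⟩
      · rcases Fin.eq_self_or_eq_succAbove i j with rfl | ⟨j, rfl⟩
        · exact absurd hij (lt_irrefl _)
        · refine Or.inr (Or.inr ⟨j, k - c, Finset.mem_union_right _ ?_, cright j c⟩)
          rw [shiTrace, if_neg ((hgt j).1 hij), Finset.mem_Icc]
          omega
      · rcases Fin.eq_self_or_eq_succAbove p j with rfl | ⟨j, rfl⟩
        · refine Or.inr (Or.inr ⟨i, k + c, Finset.mem_union_right _ ?_, cleft i c⟩)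
          rw [shiTrace, if_pos ((hlt i).1 hij), Finset.mem_Icc]
          omega
        · exact Or.inr (Or.inl ⟨i, j, by simpa using hij, c, Finset.mem_Icc.2 hc, cdiff i j c⟩)
    · rcases Fin.eq_self_or_eq_succAbove p i with rfl | ⟨i, rfl⟩
      · refine Or.inl ?_
        have hck : (k : ℝ) - c ≠ 0 := fun h => hle (by
          rw [range_insertCoord, show c = k by exact_mod_cast (sub_eq_zero.1 h).symm])
        ext v
        rw [Submodule.mem_comap, mem_coordHyperplane, mem_infHyperplane, insertCoord_self,
          insertCoord_snd, ← sub_eq_zero, ← sub_mul, mul_eq_zero, or_iff_right hck]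
      · exact Or.inr (Or.inr ⟨i, c, Finset.mem_union_left _ hc, ccoord i c⟩)
  · intro hY
    have hco := (shiCone a _).isCoatom Y hY
    rw [mem_shiCone] at hY
    rcases hY with rfl | ⟨i, j, hij, c, hc, rfl⟩ | ⟨i, c, hc, rfl⟩
    · exact mem_pullback_of_comap_eq (mem_shiCone.2 (Or.inl rfl)) cinf hco
    · exact mem_pullback_of_comap_eq (mem_shiCone.2 (Or.inr (Or.inl
        ⟨_, _, by simpa using hij, c, hc, rfl⟩))) (cdiff i j c) hco
    · rcases Finset.mem_union.1 hc with hc | hc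
      · exact mem_pullback_of_comap_eq (mem_shiCone.2 (Or.inr (Or.inr ⟨_, c, hc, rfl⟩)))
          (ccoord i c) hco
      · rw [shiTrace] at hc
        split_ifs at hc with hip <;> rw [Finset.mem_Icc] at hc
        · refine mem_pullback_of_comap_eq (mem_shiCone.2 (Or.inr (Or.inl
            ⟨p.succAbove i, p, (hlt i).2 hip, c - k, Finset.mem_Icc.2 (by omega), rfl⟩))) ?_ hco
          rw [cleft, add_sub_cancel]
        · refine mem_pullback_of_comap_eq (mem_shiCone.2 (Or.inr (Or.inl
            ⟨p, p.succAbove i, (hgt i).2 hip, k - c, Finset.mem_Icc.2 (by omega), rfl⟩))) ?_ hco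
          rw [cright, sub_sub_cancel]

/-- The addition of the hyperplane `x_p = k z`. -/
theorem shiCone_add {a : ℕ} {N N' : Fin (l + 1) → Finset ℤ} {p : Fin (l + 1)} {k : ℤ}
    (hk : k ∉ N p) (hN' : N' = Function.update N p (insert k (N p))) {m : ℕ} {e : Multiset ℕ}
    (hrestrict : ((shiCone a N').pullback (insertCoord p k)).IsInductivelyFreeWith e)
    (hdelete : (shiCone a N).IsInductivelyFreeWith (m ::ₘ e)) :
    (shiCone a N').IsInductivelyFreeWith ((m + 1) ::ₘ e) := by
  subst hN'
  refine .add_of_pullback (insertCoord_injective p k) ?_ hrestrict ?_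
  · rw [range_insertCoord, mem_shiCone]
    exact Or.inr (Or.inr ⟨p, k, by simp, rfl⟩)
  · rwa [range_insertCoord, shiCone_delete hk]

/-- The map `(x, z) ↦ (x_1 - x_0, …, x_l - x_0, z)`. -/
noncomputable def subZeroCoord (l : ℕ) :
    ((Fin (l + 1) → ℝ) × ℝ) →ₗ[ℝ] ((Fin l → ℝ) × ℝ) :=
  ((LinearMap.pi fun i : Fin l => coordForm i.succ - coordForm 0) ∘ₗ
    LinearMap.fst ℝ (Fin (l + 1) → ℝ) ℝ).prod (LinearMap.snd ℝ _ _)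

theorem subZeroCoord_fst (v : (Fin (l + 1) → ℝ) × ℝ) (i : Fin l) :
    (subZeroCoord l v).1 i = v.1 i.succ - v.1 0 := by
  simp [subZeroCoord, coordForm]

theorem subZeroCoord_snd (v : (Fin (l + 1) → ℝ) × ℝ) : (subZeroCoord l v).2 = v.2 := by
  simp [subZeroCoord]

theorem subZeroCoord_surjective : Function.Surjective (subZeroCoord l) := fun w =>
  ⟨(Fin.cons 0 w.1, w.2), Prod.ext (funext fun i => by simp [subZeroCoord_fst])
    (subZeroCoord_snd _)⟩

theorem comap_subZeroCoord_infHyperplane :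
    (infHyperplane l).comap (subZeroCoord l) = infHyperplane (l + 1) := by
  ext v
  simp [mem_infHyperplane, subZeroCoord_snd]

theorem comap_subZeroCoord_diffHyperplane (i j : Fin l) (c : ℤ) :
    (diffHyperplane i j c).comap (subZeroCoord l) = diffHyperplane i.succ j.succ c := by
  ext v
  simp [mem_diffHyperplane, subZeroCoord_fst, subZeroCoord_snd]

theorem comap_subZeroCoord_coordHyperplane (i : Fin l) (c : ℤ) :
    (coordHyperplane i c).comap (subZeroCoord l) = diffHyperplane 0 i.succ (-c) := by
  ext v
  simp only [mem_diffHyperplane, mem_coordHyperplane, subZeroCoord_fst, subZeroCoord_snd,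
    Submodule.mem_comap]
  push_cast
  constructor <;> intro h <;> linarith

/-- The cone over the extended Shi arrangement in `ℝ^{l+1}` comes from an arrangement in the
space of dimension `l + 1`. -/
theorem shiCone_empty_eq_pullback (a : ℕ) :
    shiCone a (fun _ : Fin (l + 1) => ∅) =
      (shiCone a fun _ : Fin l => Finset.Icc (-(a : ℤ)) (a - 1)).pullback (subZeroCoord l) := by
  ext Y
  rw [pullback_surjective subZeroCoord_surjective, mem_shiCone]
  constructor
  · rintro (rfl | ⟨i, j, hij, c, hc, rfl⟩ | ⟨i, c, hc, rfl⟩)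
    · exact ⟨_, mem_shiCone.2 (Or.inl rfl), comap_subZeroCoord_infHyperplane⟩
    · obtain ⟨j, rfl⟩ := Fin.exists_succ_eq.2 ((Fin.zero_le i).trans_lt hij).ne'
      rcases Fin.eq_zero_or_eq_succ i with rfl | ⟨i, rfl⟩
      · refine ⟨coordHyperplane j (-c), mem_shiCone.2 (Or.inr (Or.inr ⟨j, -c, ?_, rfl⟩)), ?_⟩
        · rw [Finset.mem_Icc] at hc ⊢
          omega
        · rw [comap_subZeroCoord_coordHyperplane, neg_neg]
      · exact ⟨_, mem_shiCone.2 (Or.inr (Or.inl ⟨i, j, by simpa using hij, c, hc, rfl⟩)),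
          comap_subZeroCoord_diffHyperplane i j c⟩
    · simp at hc
  · rintro ⟨X, hX, rfl⟩
    rcases mem_shiCone.1 hX with rfl | ⟨i, j, hij, c, hc, rfl⟩ | ⟨i, c, hc, rfl⟩
    · exact Or.inl comap_subZeroCoord_infHyperplane
    · exact Or.inr (Or.inl ⟨i.succ, j.succ, by simpa using hij, c, hc,
        comap_subZeroCoord_diffHyperplane i j c⟩)
    · refine Or.inr (Or.inl ⟨0, i.succ, Fin.succ_pos i, -c, ?_,
        comap_subZeroCoord_coordHyperplane i c⟩)
      rw [Finset.mem_Icc] at hc ⊢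
      omega

theorem subZeroCoord_comp_insertCoord_injective (p : Fin (l + 1)) (k : ℤ) :
    Function.Injective (subZeroCoord l ∘ₗ insertCoord p k) := by
  rw [← LinearMap.ker_eq_bot, LinearMap.ker_eq_bot']
  intro v hv
  set w := insertCoord p k v with hw
  have h2 : w.2 = 0 := by
    rw [← subZeroCoord_snd]
    exact congrArg Prod.snd hv
  have h1 : ∀ i, w.1 i = w.1 0 := fun i => by
    rcases Fin.eq_zero_or_eq_succ i with rfl | ⟨i, rfl⟩
    · rfl
    · have := congrFun (congrArg Prod.fst hv) i
      rw [LinearMap.comp_apply, subZeroCoord_fst] at this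
      exact sub_eq_zero.1 this
  have hp : w.1 p = 0 := by
    rw [hw, insertCoord_self, ← insertCoord_snd p k, ← hw, h2, mul_zero]
  refine insertCoord_injective p k ?_
  rw [map_zero, ← hw]
  refine Prod.ext (funext fun i => ?_) h2
  rw [h1, ← h1 p, hp]
  rfl

end ShiCone

section Weights

/-- The intervals `[a - M, a - 1]` for the first `p` indices and `[a - M - 1, a - 1]` for the
others. -/
noncomputable def stepWeight (l a M p : ℕ) (i : Fin l) : Finset ℤ :=
  if i.val < p then Finset.Icc ((a : ℤ) - M) (a - 1) else Finset.Icc ((a : ℤ) - M - 1) (a - 1)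

variable {l a M p : ℕ}

theorem stepWeight_full : stepWeight l a M l = fun _ => Finset.Icc ((a : ℤ) - M) (a - 1) :=
  funext fun i => if_pos i.2

theorem stepWeight_zero : stepWeight l a M 0 = stepWeight l a (M + 1) l := by
  rw [stepWeight_full]
  funext i
  rw [stepWeight, if_neg (Nat.not_lt_zero _)]
  congr 1
  push_cast
  ring

theorem notMem_stepWeight_succ (hp : p < l) :
    (a : ℤ) - M - 1 ∉ stepWeight l a M (p + 1) ⟨p, hp⟩ := by
  rw [stepWeight, if_pos (Nat.lt_succ_self p), Finset.mem_Icc]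
  omega

theorem stepWeight_eq_update (hp : p < l) :
    stepWeight l a M p = Function.update (stepWeight l a M (p + 1)) ⟨p, hp⟩
      (insert ((a : ℤ) - M - 1) (stepWeight l a M (p + 1) ⟨p, hp⟩)) := by
  funext i
  by_cases hi : i = ⟨p, hp⟩
  · subst hi
    rw [Function.update_self]
    ext c
    simp only [stepWeight, lt_self_iff_false, if_false, Nat.lt_succ_self, if_true,
      Finset.mem_insert, Finset.mem_Icc]
    omega
  · rw [Function.update_of_ne hi]
    have hne : i.val ≠ p := fun h => hi (Fin.ext h)
    simp only [stepWeight]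
    congr 1
    exact propext ⟨fun h => by omega, fun h => by omega⟩

theorem val_succAbove_lt_iff (p : Fin (l + 1)) (i : Fin l) :
    (p.succAbove i).val < p.val ↔ i.val < p.val := by
  rw [← Fin.lt_def, Fin.succAbove_lt_iff_castSucc_lt, Fin.lt_def, Fin.val_castSucc]

theorem pullback_stepWeight_of_le (hM : a ≤ M) (p : Fin (l + 1)) :
    (shiCone a (stepWeight (l + 1) a M p)).pullback (insertCoord p ((a : ℤ) - M - 1)) =
      shiCone a (stepWeight l a (M + a) p) := by
  rw [shiCone_pullback_insertCoord]
  congr 1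
  funext i
  ext c
  simp only [stepWeight, shiTrace, val_succAbove_lt_iff, Finset.mem_union]
  split_ifs <;> simp only [Finset.mem_Icc] <;> push_cast <;> omega

theorem pullback_stepWeight_of_lt (hM : M < a) (p : Fin (l + 1)) :
    (shiCone a (stepWeight (l + 1) a M p)).pullback (insertCoord p ((a : ℤ) - M - 1)) =
      (shiCone a fun _ : Fin (l + 1) => ∅).pullback (insertCoord p ((a : ℤ) - M - 1)) := by
  rw [shiCone_pullback_insertCoord, shiCone_pullback_insertCoord]
  congr 1
  funext i
  ext c
  simp only [stepWeight, shiTrace, val_succAbove_lt_iff, Finset.mem_union, Finset.notMem_empty,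
    false_or]
  split_ifs <;> simp only [Finset.mem_Icc] <;> omega

theorem pullback_stepWeight_full (hM : a ≤ M) :
    (shiCone a (stepWeight (l + 1) a M (l + 1))).pullback (insertCoord 0 ((a : ℤ) - M)) =
      shiCone a (stepWeight l a (M + a) l) := by
  rw [shiCone_pullback_insertCoord, stepWeight_full, stepWeight_full]
  congr 1
  funext i
  ext c
  simp only [shiTrace, Fin.val_zero, Nat.not_lt_zero, if_false, Finset.mem_union, Finset.mem_Icc]
  push_cast
  omega

end Weights

section InductiveFreeness

/-- The exponents `(1, c^p, (c + 1)^q)`. -/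
def shiExponents (p q c : ℕ) : List ℕ :=
  1 :: (List.replicate p c ++ List.replicate q (c + 1))

theorem coe_shiExponents (p q c : ℕ) : (shiExponents p q c : Multiset ℕ) =
    1 ::ₘ (Multiset.replicate p c + Multiset.replicate q (c + 1)) := by
  rw [shiExponents, ← Multiset.cons_coe, ← Multiset.coe_add, Multiset.coe_replicate,
    Multiset.coe_replicate]

theorem shiExponents_pairwise {p q c : ℕ} (hc : 0 < p + q → 1 ≤ c) :
    (shiExponents p q c).Pairwise (· ≤ ·) := by
  rw [shiExponents, List.pairwise_cons, List.pairwise_append]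
  refine ⟨fun x hx => ?_, List.pairwise_replicate.2 (Or.inr le_rfl),
    List.pairwise_replicate.2 (Or.inr le_rfl), fun x hx y hy => ?_⟩
  · rcases List.mem_append.1 hx with hx | hx <;> obtain ⟨hn, rfl⟩ := List.mem_replicate.1 hx
    · exact hc (by omega)
    · omega
  · rw [(List.mem_replicate.1 hx).2, (List.mem_replicate.1 hy).2]
    omega

theorem coe_shiExponents_succ_left (p q c : ℕ) :
    (shiExponents (p + 1) q c : Multiset ℕ) = c ::ₘ (shiExponents p q c : Multiset ℕ) := by
  rw [coe_shiExponents, coe_shiExponents, Multiset.replicate_succ, Multiset.cons_add,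
    Multiset.cons_swap]

theorem coe_shiExponents_succ_right (p q c : ℕ) :
    (shiExponents p (q + 1) c : Multiset ℕ) = (c + 1) ::ₘ (shiExponents p q c : Multiset ℕ) := by
  rw [coe_shiExponents, coe_shiExponents, Multiset.replicate_succ, Multiset.add_cons,
    Multiset.cons_swap]

theorem shiExponents_succ_right (p q c : ℕ) :
    shiExponents p (q + 1) c = shiExponents p q c ++ [c + 1] := by
  simp [shiExponents, List.replicate_succ']

theorem shiExponents_succ_left (p c : ℕ) :
    shiExponents (p + 1) 0 c = shiExponents p 0 c ++ [c] := by
  simp [shiExponents, List.replicate_succ']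

theorem isInductivelyFreeWith_shiCone_zero (a : ℕ) (N : Fin 0 → Finset ℤ) :
    (shiCone a N).IsInductivelyFreeWith ([1] : List ℕ) := by
  have hmem : ∀ Y, Y ∈ (shiCone a N).hyperplanes ↔ Y = infHyperplane 0 := fun Y => by
    rw [mem_shiCone]
    simp
  have hinf : infHyperplane 0 ∈ (shiCone a N).hyperplanes := (hmem _).2 rfl
  have hfr : Module.finrank ℝ ((Fin 0 → ℝ) × ℝ) = 1 := by simp
  have hH := finrank_add_one_of_isCoatom ((shiCone a N).isCoatom _ hinf)
  refine .add _ _ hinf 0 0 ?_ ?_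
  · have h0 : (shiCone a N).restrict (infHyperplane 0) = CentralArrangement.empty ℝ _ := by
      ext Y
      refine ⟨?_, fun h => h.elim⟩
      rintro ⟨X, hX, hle, rfl⟩
      exact hle ((hmem X).1 hX).ge
    have := IsInductivelyFreeWith.empty (K := ℝ) (infHyperplane 0)
    rw [show Module.finrank ℝ (infHyperplane 0) = 0 by omega, Multiset.replicate_zero] at this
    rwa [h0]
  · have h0 : (shiCone a N).delete (infHyperplane 0) = CentralArrangement.empty ℝ _ := by
      ext Y
      exact ⟨fun h => h.2 ((hmem Y).1 h.1), fun h => h.elim⟩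
    have := IsInductivelyFreeWith.empty (K := ℝ) ((Fin 0 → ℝ) × ℝ)
    rw [hfr] at this
    rwa [h0]

theorem isInductivelyFreeWith_pullback_shiCone_empty {l a : ℕ} {e : Multiset ℕ}
    (h : (shiCone a (stepWeight l a (a + a) l)).IsInductivelyFreeWith e) (p : Fin (l + 1)) (k : ℤ) :
    ((shiCone a fun _ : Fin (l + 1) => ∅).pullback (insertCoord p k)).IsInductivelyFreeWith e := by
  have hN : stepWeight l a (a + a) l = fun _ => Finset.Icc (-(a : ℤ)) (a - 1) := by
    rw [stepWeight_full]
    push_cast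
    rw [sub_add_cancel_left]
  rw [shiCone_empty_eq_pullback, pullback_pullback, ← hN]
  exact h.pullback_equiv
    (LinearEquiv.ofInjectiveEndo _ (subZeroCoord_comp_insertCoord_injective p k))

theorem isInductivelyFreeWith_shiCone_empty {l a : ℕ} {e : Multiset ℕ}
    (h : (shiCone a (stepWeight l a (a + a) l)).IsInductivelyFreeWith e) :
    (shiCone a fun _ : Fin (l + 1) => ∅).IsInductivelyFreeWith (0 ::ₘ e) := by
  have hN : stepWeight l a (a + a) l = fun _ => Finset.Icc (-(a : ℤ)) (a - 1) := by
    rw [stepWeight_full]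
    push_cast
    rw [sub_add_cancel_left]
  rw [shiCone_empty_eq_pullback, ← hN]
  have := h.pullback_of_surjective (subZeroCoord_surjective (l := l)) (k := 1) (by simp)
  rwa [Multiset.replicate_one, add_comm e, Multiset.singleton_add] at this

/-- Adding the hyperplanes `x_p = k z` one by one, for `k` from `a - 1` down to `0`. -/
theorem isInductivelyFreeWith_shiCone_of_le {l a : ℕ} {e : Multiset ℕ}
    (h : (shiCone a (stepWeight l a (a + a) l)).IsInductivelyFreeWith e) {M : ℕ} (hM : M ≤ a) :
    (shiCone a (stepWeight (l + 1) a M (l + 1))).IsInductivelyFreeWith ((M * (l + 1)) ::ₘ e) := by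
  induction M with
  | zero =>
    have hN : stepWeight (l + 1) a 0 (l + 1) = fun _ => ∅ := by
      rw [stepWeight_full]
      simp
    rw [hN, zero_mul]
    exact isInductivelyFreeWith_shiCone_empty h
  | succ M ih =>
    have key : ∀ q, q ≤ l + 1 → (shiCone a (stepWeight (l + 1) a M (l + 1 - q))).IsInductivelyFreeWith
        ((M * (l + 1) + q) ::ₘ e) := by
      intro q
      induction q with
      | zero => exact fun _ => ih (by omega)
      | succ q ihq =>
        intro hq
        have hp : l + 1 - (q + 1) < l + 1 := by omega
        refine shiCone_add (notMem_stepWeight_succ hp) (stepWeight_eq_update hp) ?_ ?_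
        · rw [pullback_stepWeight_of_lt (by omega) ⟨l + 1 - (q + 1), hp⟩]
          exact isInductivelyFreeWith_pullback_shiCone_empty h _ _
        · rw [show l + 1 - (q + 1) + 1 = l + 1 - q by omega]
          exact ihq (by omega)
    have := key (l + 1) le_rfl
    rwa [Nat.sub_self, stepWeight_zero, ← Nat.succ_mul] at this

theorem isInductivelyFreeWith_shiCone (l a : ℕ) : ∀ r p : ℕ, p ≤ l →
    (shiCone a (stepWeight l a (a + r) p)).IsInductivelyFreeWith
      (shiExponents p (l - p) (r + a * l) : Multiset ℕ) := by
  induction l with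
  | zero =>
    intro r p hp
    obtain rfl : p = 0 := by omega
    exact isInductivelyFreeWith_shiCone_zero a _
  | succ l ih =>
    have hstep : ∀ r, (shiCone a (stepWeight (l + 1) a (a + r) (l + 1))).IsInductivelyFreeWith
        (shiExponents (l + 1) 0 (r + a * (l + 1)) : Multiset ℕ) → ∀ q, q ≤ l + 1 →
        (shiCone a (stepWeight (l + 1) a (a + r) (l + 1 - q))).IsInductivelyFreeWith
          (shiExponents (l + 1 - q) q (r + a * (l + 1)) : Multiset ℕ) := by
      intro r h0 q
      induction q with
      | zero => exact fun _ => h0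
      | succ q ihq =>
        intro hq
        have hp : l + 1 - (q + 1) < l + 1 := by omega
        rw [coe_shiExponents_succ_right]
        refine shiCone_add (notMem_stepWeight_succ hp) (stepWeight_eq_update hp) ?_ ?_
        · rw [pullback_stepWeight_of_le (by omega) ⟨l + 1 - (q + 1), hp⟩]
          have := ih (r + a) (l + 1 - (q + 1)) (by omega)
          rwa [show l - (l + 1 - (q + 1)) = q by omega,
            show r + a + a * l = r + a * (l + 1) by ring, ← add_assoc] at this
        · rw [← coe_shiExponents_succ_left, show l + 1 - (q + 1) + 1 = l + 1 - q by omega]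
          exact ihq (by omega)
    have hfull : ∀ r, (shiCone a (stepWeight (l + 1) a (a + r) (l + 1))).IsInductivelyFreeWith
        (shiExponents (l + 1) 0 (r + a * (l + 1)) : Multiset ℕ) := by
      intro r
      induction r with
      | zero =>
        have h1 := ih a l le_rfl
        rw [Nat.sub_self, show a + a * l = a * (l + 1) by ring] at h1
        have := isInductivelyFreeWith_shiCone_of_le h1 le_rfl
        rwa [zero_add, coe_shiExponents_succ_left]
      | succ r ihr =>
        have := hstep r ihr (l + 1) le_rfl
        rw [Nat.sub_self, stepWeight_zero] at this
        have he : (shiExponents 0 (l + 1) (r + a * (l + 1)) : Multiset ℕ) =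
            (shiExponents (l + 1) 0 (r + 1 + a * (l + 1)) : Multiset ℕ) := by
          rw [coe_shiExponents, coe_shiExponents, Multiset.replicate_zero, Multiset.replicate_zero,
            zero_add, add_zero, Nat.add_right_comm]
        rwa [he] at this
    intro r p hp
    have := hstep r (hfull r) (l + 1 - p) (by omega)
    rwa [Nat.sub_sub_self hp] at this

theorem hasInductiveFlag_shiCone (l : ℕ) {a : ℕ} (ha : 1 ≤ a) : ∀ r p : ℕ, p ≤ l →
    (shiCone a (stepWeight l a (a + r) p)).HasInductiveFlag
      (shiExponents p (l - p) (r + a * l)) := by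
  induction l with
  | zero =>
    intro r p hp
    obtain rfl : p = 0 := by omega
    exact .base _ 1 (isInductivelyFreeWith_shiCone_zero a _)
  | succ l ih =>
    intro r p hp
    have hfree := isInductivelyFreeWith_shiCone (l + 1) a r p hp
    have hc : r + a + a * l = r + a * (l + 1) := by ring
    rcases Nat.lt_or_ge p (l + 1) with hlt | hge
    · have hsub : l + 1 - p = (l - p) + 1 := by omega
      rw [hsub, shiExponents_succ_right] at hfree ⊢
      refine .step _ (insertCoord ⟨p, hlt⟩ ((a : ℤ) - ((a + r : ℕ) : ℤ) - 1))
        (insertCoord_injective _ _) ?_ _ _ ?_ hfree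
      · rw [range_insertCoord, mem_shiCone, stepWeight_eq_update hlt]
        exact Or.inr (Or.inr ⟨⟨p, hlt⟩, _, by simp, rfl⟩)
      · rw [pullback_stepWeight_of_le (by omega) ⟨p, hlt⟩]
        have := ih (r + a) p (by omega)
        rwa [hc, ← add_assoc] at this
    · obtain rfl : p = l + 1 := by omega
      rw [Nat.sub_self, shiExponents_succ_left] at hfree ⊢
      refine .step _ (insertCoord 0 ((a : ℤ) - ((a + r : ℕ) : ℤ)))
        (insertCoord_injective _ _) ?_ _ _ ?_ hfree
      · rw [range_insertCoord, mem_shiCone]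
        refine Or.inr (Or.inr ⟨0, _, ?_, rfl⟩)
        rw [stepWeight_full, Finset.mem_Icc]
        push_cast
        omega
      · rw [pullback_stepWeight_full (by omega)]
        have := ih (r + a) l le_rfl
        rwa [hc, ← add_assoc, Nat.sub_self] at this

end InductiveFreeness

section Isomorphisms

variable {l : ℕ}

/-- The linear map `(x, z) ↦ (x_i - t z, z)`. -/
noncomputable def translation (l : ℕ) (t : ℤ) :
    ((Fin l → ℝ) × ℝ) →ₗ[ℝ] ((Fin l → ℝ) × ℝ) :=
  (LinearMap.pi fun i => coordForm i ∘ₗ LinearMap.fst ℝ (Fin l → ℝ) ℝ -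
    (t : ℝ) • LinearMap.snd ℝ (Fin l → ℝ) ℝ).prod (LinearMap.snd ℝ _ _)

theorem translation_fst (t : ℤ) (v : (Fin l → ℝ) × ℝ) (i : Fin l) :
    (translation l t v).1 i = v.1 i - t * v.2 := by
  simp [translation, coordForm]

theorem translation_snd (t : ℤ) (v : (Fin l → ℝ) × ℝ) : (translation l t v).2 = v.2 := by
  simp [translation]

theorem translation_injective (t : ℤ) : Function.Injective (translation l t) := by
  intro v w h
  have h2 : v.2 = w.2 := by rw [← translation_snd t v, h, translation_snd]
  refine Prod.ext (funext fun i => ?_) h2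
  have h1 := congrFun (congrArg Prod.fst h) i
  rw [translation_fst, translation_fst, h2] at h1
  exact sub_left_injective h1

theorem shiCone_pullback_translation {a : ℕ} {N N' : Fin l → Finset ℤ} {t : ℤ}
    (h : ∀ i c, c + t ∈ N' i ↔ c ∈ N i) :
    (shiCone a N).pullback (LinearEquiv.ofInjectiveEndo _ (translation_injective t)).toLinearMap =
      shiCone a N' := by
  set τ := (LinearEquiv.ofInjectiveEndo _ (translation_injective (l := l) t)).toLinearMap
  have hτ : ∀ v, τ v = translation l t v := fun v => rfl
  have cinf : (infHyperplane l).comap τ = infHyperplane l := by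
    ext v
    simp [mem_infHyperplane, hτ, translation_snd]
  have cdiff : ∀ (i j : Fin l) (c : ℤ), (diffHyperplane i j c).comap τ = diffHyperplane i j c :=
    fun i j c => by
      ext v
      simp [mem_diffHyperplane, hτ, translation_fst, translation_snd]
  have ccoord : ∀ (i : Fin l) (c : ℤ), (coordHyperplane i c).comap τ = coordHyperplane i (c + t) :=
    fun i c => by
      ext v
      simp only [mem_coordHyperplane, hτ, translation_fst, translation_snd, Submodule.mem_comap]
      push_cast
      constructor <;> intro h <;> linarith
  ext Y
  rw [pullback_surjective (LinearEquiv.surjective _), mem_shiCone]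
  constructor
  · rintro ⟨X, hX, rfl⟩
    rcases mem_shiCone.1 hX with rfl | ⟨i, j, hij, c, hc, rfl⟩ | ⟨i, c, hc, rfl⟩
    · exact Or.inl cinf
    · exact Or.inr (Or.inl ⟨i, j, hij, c, hc, cdiff i j c⟩)
    · exact Or.inr (Or.inr ⟨i, c + t, (h i c).2 hc, ccoord i c⟩)
  · rintro (rfl | ⟨i, j, hij, c, hc, rfl⟩ | ⟨i, c, hc, rfl⟩)
    · exact ⟨_, mem_shiCone.2 (Or.inl rfl), cinf⟩
    · exact ⟨_, mem_shiCone.2 (Or.inr (Or.inl ⟨i, j, hij, c, hc, rfl⟩)), cdiff i j c⟩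
    · refine ⟨_, mem_shiCone.2 (Or.inr (Or.inr ⟨i, c - t, (h i _).1 ?_, rfl⟩)), ?_⟩
      · rwa [sub_add_cancel]
      · rw [ccoord, sub_add_cancel]

/-- The map `(x, z) ↦ (x_1 - x_0, …, x_l - x_0, z)` on the reflection representation of type
`A_l`. -/
noncomputable def typeAMap (l : ℕ) : (typeASpace l × ℝ) →ₗ[ℝ] ((Fin l → ℝ) × ℝ) :=
  subZeroCoord l ∘ₗ (typeASpace l).subtype.prodMap LinearMap.id

theorem typeAMap_injective : Function.Injective (typeAMap l) := by
  rw [← LinearMap.ker_eq_bot, LinearMap.ker_eq_bot']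
  rintro ⟨⟨x, hx⟩, z⟩ hv
  have hz : z = 0 := by
    have := congrArg Prod.snd hv
    rwa [typeAMap, LinearMap.comp_apply, subZeroCoord_snd] at this
  have h1 : ∀ i, x i = x 0 := fun i => by
    rcases Fin.eq_zero_or_eq_succ i with rfl | ⟨i, rfl⟩
    · rfl
    · have := congrFun (congrArg Prod.fst hv) i
      rw [typeAMap, LinearMap.comp_apply, subZeroCoord_fst] at this
      exact sub_eq_zero.1 this
  have h2 : ∑ i, x i = 0 := by
    simpa [typeASpace, coordForm] using hx
  rw [Finset.sum_congr rfl fun i _ => h1 i, Finset.sum_const, Finset.card_univ, Fintype.card_fin,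
    nsmul_eq_mul, mul_eq_zero] at h2
  have h3 : x 0 = 0 := h2.resolve_left (by positivity)
  refine Prod.ext (Subtype.ext (funext fun i => ?_)) hz
  exact (h1 i).trans h3

theorem finrank_typeASpace (l : ℕ) : Module.finrank ℝ (typeASpace l) = l := by
  have h0 : (∑ i, coordForm i : Module.Dual ℝ (Fin (l + 1) → ℝ)) ≠ 0 := fun h => by
    simpa [coordForm] using LinearMap.congr_fun h (Pi.single 0 1)
  have := Module.Dual.finrank_ker_add_one_of_ne_zero h0
  rw [Module.finrank_fin_fun] at this
  exact Nat.succ_injective this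

/-- `typeAMap` as an isomorphism. -/
noncomputable def typeAEquiv (l : ℕ) : (typeASpace l × ℝ) ≃ₗ[ℝ] ((Fin l → ℝ) × ℝ) :=
  LinearEquiv.ofBijective (typeAMap l) ⟨typeAMap_injective,
    (LinearMap.injective_iff_surjective_of_finrank_eq_finrank (by
      simp [finrank_typeASpace])).1 typeAMap_injective⟩

theorem typeAEquiv_fst (v : typeASpace l × ℝ) (i : Fin l) :
    (typeAEquiv l v).1 i = v.1.1 i.succ - v.1.1 0 :=
  subZeroCoord_fst _ _

theorem typeAEquiv_snd (v : typeASpace l × ℝ) : (typeAEquiv l v).2 = v.2 :=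
  subZeroCoord_snd _

theorem cone_extendedShiA (l m : ℕ) : (extendedShiA l m).cone =
    (shiCone m fun _ : Fin l => Finset.Icc (-(m : ℤ)) (m - 1)).pullback
      (typeAEquiv l).toLinearMap := by
  have cinf : (infHyperplane l).comap (typeAEquiv l).toLinearMap =
      LinearMap.ker (LinearMap.snd ℝ (typeASpace l) ℝ) := by
    ext v
    simp [mem_infHyperplane, typeAEquiv_snd]
  have cdiff : ∀ (i j : Fin l) (c : ℤ), (diffHyperplane i j c).comap (typeAEquiv l).toLinearMap =
      homogenizedHyperplane (rootForm i.succ j.succ) (c : ℝ) := fun i j c => by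
    ext v
    simp [mem_diffHyperplane, mem_homogenizedHyperplane, typeAEquiv_fst, typeAEquiv_snd, rootForm,
      coordForm]
  have ccoord : ∀ (i : Fin l) (c : ℤ), (coordHyperplane i c).comap (typeAEquiv l).toLinearMap =
      homogenizedHyperplane (rootForm 0 i.succ) ((-c : ℤ) : ℝ) := fun i c => by
    ext v
    simp only [mem_coordHyperplane, mem_homogenizedHyperplane, typeAEquiv_fst, typeAEquiv_snd,
      rootForm, coordForm, Submodule.mem_comap, LinearEquiv.coe_coe, LinearMap.comp_apply,
      LinearMap.sub_apply, LinearMap.proj_apply, Submodule.subtype_apply]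
    push_cast
    constructor <;> intro h <;> linarith
  ext Y
  rw [pullback_surjective (LinearEquiv.surjective _)]
  constructor
  · rintro (rfl | ⟨φ, c, hφ, ⟨i, j, hij, k, hk, h⟩, rfl⟩)
    · exact ⟨_, mem_shiCone.2 (Or.inl rfl), cinf⟩
    · rw [homogenizedHyperplane_congr hφ (rootForm_ne_zero hij) h]
      obtain ⟨j, rfl⟩ := Fin.exists_succ_eq.2 ((Fin.zero_le i).trans_lt hij).ne'
      rcases Fin.eq_zero_or_eq_succ i with rfl | ⟨i, rfl⟩
      · refine ⟨coordHyperplane j (-k), mem_shiCone.2 (Or.inr (Or.inr ⟨j, -k, ?_, rfl⟩)), ?_⟩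
        · rw [Finset.mem_Icc] at hk ⊢
          omega
        · rw [ccoord, neg_neg]
      · exact ⟨_, mem_shiCone.2 (Or.inr (Or.inl ⟨i, j, by simpa using hij, k, hk, rfl⟩)),
          cdiff i j k⟩
  · rintro ⟨X, hX, rfl⟩
    rcases mem_shiCone.1 hX with rfl | ⟨i, j, hij, c, hc, rfl⟩ | ⟨i, c, hc, rfl⟩
    · exact Or.inl cinf
    · have hij' : i.succ < j.succ := by simpa using hij
      exact Or.inr ⟨_, _, rootForm_ne_zero hij', ⟨_, _, hij', c, hc, rfl⟩, cdiff i j c⟩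
    · refine Or.inr ⟨_, _, rootForm_ne_zero (Fin.succ_pos i),
        ⟨_, _, Fin.succ_pos i, -c, ?_, rfl⟩, ccoord i c⟩
      rw [Finset.mem_Icc] at hc ⊢
      omega

end Isomorphisms

section Main

theorem hasInductiveFlag_cone_shiLike {m a n l p : ℕ} (ha : 1 ≤ a) (hn : 1 ≤ n) (hp : p ≤ l) :
    (shiLike l p m a n).cone.HasInductiveFlag
      (shiExponents p (l - p) (m + (n - 1) * a + a * l)) := by
  have h := hasInductiveFlag_shiCone l ha (m + (n - 1) * a) p hp
  have h' := h.pullback_equiv (LinearEquiv.ofInjectiveEndo _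
    (translation_injective (l := l) (((n - 1) * a : ℕ) : ℤ)))
  rwa [shiCone_pullback_translation (N' := fun i => if i.val < p then
    Finset.Icc (-(m : ℤ)) (n * a - 1) else Finset.Icc (-(m : ℤ) - 1) (n * a - 1))] at h'
  intro i c
  obtain ⟨n, rfl⟩ := Nat.exists_eq_add_of_le' hn
  rw [Nat.add_sub_cancel, stepWeight]
  have hna : ((n + 1 : ℕ) : ℤ) * a = ((n * a : ℕ) : ℤ) + a := by
    push_cast
    ring
  rw [hna]
  generalize n * a = s
  split_ifs <;> simp only [Finset.mem_Icc] <;> push_cast <;> constructor <;> intro h <;> omega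

theorem shiDescendant_one_eq_shiLike (m d l p : ℕ) :
    shiDescendant l p 1 m d = shiLike l p m 1 (d + 1) := by
  have hD : (fun i j : Fin l => (if i < j then ({0} : Finset ℤ) else ∅) ∪
      @ite _ ((shiDigraph l 1).Adj i j) (Classical.propDecidable _) {1} ∅) =
      fun i j => if i < j then Finset.Icc (1 - ((1 : ℕ) : ℤ)) ((1 : ℕ) : ℤ) else ∅ := by
    funext i j
    by_cases hij : i < j
    · have hadj : (shiDigraph l 1).Adj i j := ⟨hij, by omega⟩
      rw [if_pos hij, if_pos hadj, if_pos hij]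
      rfl
    · have hadj : ¬ (shiDigraph l 1).Adj i j := fun h => hij h.1
      rw [if_neg hij, if_neg hadj, if_neg hij, Finset.empty_union]
  have hN : shiWeight l p 1 m d = fun i => if i.val < p then
      Finset.Icc (-(m : ℤ)) (((d + 1 : ℕ) : ℤ) * ((1 : ℕ) : ℤ) - 1)
      else Finset.Icc (-(m : ℤ) - 1) (((d + 1 : ℕ) : ℤ) * ((1 : ℕ) : ℤ) - 1) := by
    funext i
    have hi := i.2
    have hmin : min ((l : ℤ) - (i.val + 1) + 1) ((1 : ℕ) : ℤ) = 1 := by omega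
    have hip : ((i.val : ℤ) + 1 ≤ p) ↔ i.val < p := by omega
    simp only [shiWeight, hmin, hip]
    split_ifs <;> congr 1 <;> push_cast <;> ring
  change deformation _ _ = deformation _ _
  rw [hN]
  exact congrArg (fun D => deformation D _) hD

theorem hasInductiveFlag_cone_extendedShiA {m : ℕ} (l : ℕ) (hm : 1 ≤ m) :
    (extendedShiA l m).cone.HasInductiveFlag (shiExponents l 0 (m + m * l)) := by
  have h := hasInductiveFlag_shiCone l hm m l le_rfl
  have hN : stepWeight l m (m + m) l = fun _ => Finset.Icc (-(m : ℤ)) (m - 1) := by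
    rw [stepWeight_full]
    push_cast
    rw [sub_add_cancel_left]
  rw [hN, Nat.sub_self] at h
  rw [cone_extendedShiA]
  exact h.pullback_equiv _

/-- The cone over `H^p_l(m, a, n)` is ind-flag-accurate with exponents
`(1, 0^p, 1^{l-p}) + (0, (m + a(l+n-1))^l)`; hence so is the cone over the origin
`A^{p,1}_l(m, d) = H^p_l(m, 1, d+1)` of each row of the Shi descendant matrix, with exponents
`(1, (l+m+d)^p, (l+m+d+1)^{l-p})`, and the cones over the extended Shi arrangements of type `A`
are ind-flag-accurate. -/
theorem theorem6 :
    (∀ m a n l p : ℕ, 1 ≤ a → 1 ≤ n → 1 ≤ l → p ≤ l →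
      (shiLike l p m a n).cone.IsIndFlagAccurate ∧
      (shiLike l p m a n).cone.IsFreeWithExponents
        ({1} + Multiset.replicate p (0 + (m + a * (l + n - 1))) +
          Multiset.replicate (l - p) (1 + (m + a * (l + n - 1))))) ∧
    (∀ m d l p : ℕ, 1 ≤ l → p ≤ l →
      shiDescendant l p 1 m d = shiLike l p m 1 (d + 1) ∧
      (shiDescendant l p 1 m d).cone.IsIndFlagAccurate ∧
      (shiDescendant l p 1 m d).cone.IsFreeWithExponents
        ({1} + Multiset.replicate p (l + m + d) + Multiset.replicate (l - p) (l + m + d + 1))) ∧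
    (∀ m l : ℕ, 1 ≤ m → 1 ≤ l → (extendedShiA l m).cone.IsIndFlagAccurate) := by
  have key : ∀ m a n l p : ℕ, 1 ≤ a → 1 ≤ n → 1 ≤ l → p ≤ l →
      (shiLike l p m a n).cone.IsIndFlagAccurate ∧
      (shiLike l p m a n).cone.IsFreeWithExponents
        ({1} + Multiset.replicate p (0 + (m + a * (l + n - 1))) +
          Multiset.replicate (l - p) (1 + (m + a * (l + n - 1)))) := by
    intro m a n l p ha hn hl hp
    have h := hasInductiveFlag_cone_shiLike (m := m) ha hn hp
    have hpos : 1 ≤ a * l := Nat.mul_pos ha hl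
    have hc : m + (n - 1) * a + a * l = m + a * (l + n - 1) := by
      obtain ⟨n, rfl⟩ := Nat.exists_eq_add_of_le' hn
      rw [Nat.add_sub_cancel, ← add_assoc, Nat.add_sub_cancel]
      ring
    refine ⟨h.isIndFlagAccurate (shiExponents_pairwise fun _ => by omega), ?_⟩
    have hfree := h.isInductivelyFreeWith.isFreeWithExponents
    rw [hc, coe_shiExponents] at hfree
    rwa [zero_add, add_comm 1, add_assoc, Multiset.singleton_add]
  refine ⟨key, fun m d l p hl hp => ?_, fun m l hm hl => ?_⟩
  · refine ⟨shiDescendant_one_eq_shiLike m d l p, ?_⟩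
    rw [shiDescendant_one_eq_shiLike]
    have := key m 1 (d + 1) l p le_rfl (by omega) hl hp
    rwa [show 0 + (m + 1 * (l + (d + 1) - 1)) = l + m + d by omega,
      show 1 + (m + 1 * (l + (d + 1) - 1)) = l + m + d + 1 by omega] at this
  · have hpos : 1 ≤ m * l := Nat.mul_pos hm hl
    exact (hasInductiveFlag_cone_extendedShiA l hm).isIndFlagAccurate
      (shiExponents_pairwise fun _ => by omega)

end Main
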